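/- Let $d\ge 3$, let $\mathcal H=\mathbb C^d$ with computational basis $|0\rangle,\dots,|d-1\rangle$, and let $\mathcal H_A,\mathcal H_B$ be finite-dimensional complex Hilbert spaces. Write $\mathcal D(\mathcal H)$ for the set of density matrices on $\mathcal H$, $\mathcal D^{\mathrm R}(\mathcal H)$ for those with real entries in the computational basis, and $\mathcal P^{\mathrm R}(\mathcal H)$ for the pure (rank-one) states in $\mathcal D^{\mathrm R}(\mathcal H)$. Let $M:\mathcal H\to\mathcal H_A\otimes\mathcal H_B$ be an isometry, put $M(\rho)=M\rho M^\dagger$, and suppose that $M$ masks $\mathcal D^{\mathrm R}(\mathcal H)$, i.e. there are fixed density matrices $\tau_A,\tau_B$ with $\operatorname{tr}_B M(\rho)=\tau_A$ and $\operatorname{tr}_A M(\rho)=\tau_B$ for all $\rho\in\mathcal D^{\mathrm R}(\mathcal H)$. Let $|\Psi_0\rangle=M|0\rangle$. Then: 1. For every $\rho\in\mathcal D(\mathcal H)$ the state $M(\rho)$ can be created from $|\Psi_0\rangle\langle\Psi_0|$ by (finitely many rounds of) local operations and classical communication (LOCC). 2. $E(M(\rho))\le E(|\Psi_0\rangle\langle\Psi_0|)$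 for every $\rho\in\mathcal D(\mathcal H)$ and every entanglement monotone $E$, i.e. every real-valued function $E$ of the states on $\mathcal H_A\otimes\mathcal H_B$ that does not increase under LOCC. 3. If moreover $E$ is convex and strict, where strict means that $E(|\Psi_1\rangle\langle\Psi_1|)>E(|\Psi_2\rangle\langle\Psi_2|)$ for all pure states such that $|\Psi_1\rangle$ can be turned into $|\Psi_2\rangle$ by LOCC but not vice versa, then for every $\rho\in\mathcal D(\mathcal H)$ one has $E(M(\rho))=E(|\Psi_0\rangle\langle\Psi_0|)$ if and only if $\rho\in\mathcal P^{\mathrm R}(\mathcal H)$. -/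

import Mathlib

open scoped Kronecker Matrix ComplexOrder

noncomputable section

namespace Masking

/-- Density matrices indexed by `ι`: positive semidefinite with unit trace. -/
def states (ι : Type) [Fintype ι] : Set (Matrix ι ι ℂ) :=
  {ρ | ρ.PosSemidef ∧ ρ.trace = 1}

/-- The operator `|ψ⟩⟨ψ|`. -/
def proj {ι : Type} (ψ : ι → ℂ) : Matrix ι ι ℂ :=
  Matrix.vecMulVec ψ (star ψ)

/-- Pure states: density matrices of the form `|ψ⟩⟨ψ|`
(unit trace forces `ψ` to be a unit vector). -/
def pureStates (ι : Type) [Fintype ι] : Set (Matrix ι ι ℂ) :=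
  {ρ | ρ ∈ states ι ∧ ∃ ψ : ι → ℂ, ρ = proj ψ}

/-- Density matrices whose entries in the computational basis are all real. -/
def realStates (ι : Type) [Fintype ι] : Set (Matrix ι ι ℂ) :=
  {ρ | ρ ∈ states ι ∧ ∀ i j, (ρ i j).im = 0}

/-- Real pure states. -/
def realPureStates (ι : Type) [Fintype ι] : Set (Matrix ι ι ℂ) :=
  pureStates ι ∩ realStates ι

/-- Partial trace over the second subsystem. -/
def traceB {a b : ℕ} (X : Matrix (Fin a × Fin b) (Fin a × Fin b) ℂ) :
    Matrix (Fin a) (Fin a) ℂ :=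
  Matrix.of fun i j => ∑ k, X (i, k) (j, k)

/-- Partial trace over the first subsystem. -/
def traceA {a b : ℕ} (X : Matrix (Fin a × Fin b) (Fin a × Fin b) ℂ) :
    Matrix (Fin b) (Fin b) ℂ :=
  Matrix.of fun i j => ∑ k, X (k, i) (k, j)

/-- `M` is an isometry `ℂ^d → ℂ^a ⊗ ℂ^b` such that both reduced states of `M ρ M†` are the same
for all `ρ ∈ S`. -/
def IsMasker {d a b : ℕ} (M : Matrix (Fin a × Fin b) (Fin d) ℂ)
    (S : Set (Matrix (Fin d) (Fin d) ℂ)) : Prop :=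
  Mᴴ * M = 1 ∧
    ∃ τA ∈ states (Fin a), ∃ τB ∈ states (Fin b),
      ∀ ρ ∈ S, traceB (M * ρ * Mᴴ) = τA ∧ traceA (M * ρ * Mᴴ) = τB

/-- A finite-round protocol of local operations and classical communication that starts on
`ℂ^a ⊗ ℂ^b` and ends on `ℂ^a' ⊗ ℂ^b'`. At each step one party performs a local quantum measurement
given by Kraus operators `K i` with `∑ i, (K i)† (K i) = 1`, whose output dimension may be arbitrary
and may depend on the outcome, and announces the outcome `i`; the rest of the protocol may
depend on `i`. A general local channel is a step whose outcome is afterwards ignored. -/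
inductive LOCCProtocol (a' b' : ℕ) : ℕ → ℕ → Type
  | done : LOCCProtocol a' b' a' b'
  | alice {a b k : ℕ} (c : Fin k → ℕ) (K : ∀ i, Matrix (Fin (c i)) (Fin a) ℂ)
      (hK : ∑ i, (K i)ᴴ * K i = 1)
      (next : ∀ i, LOCCProtocol a' b' (c i) b) : LOCCProtocol a' b' a b
  | bob {a b k : ℕ} (c : Fin k → ℕ) (K : ∀ i, Matrix (Fin (c i)) (Fin b) ℂ)
      (hK : ∑ i, (K i)ᴴ * K i = 1)
      (next : ∀ i, LOCCProtocol a' b' a (c i)) : LOCCProtocol a' b' a b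

/-- The quantum channel implemented by a protocol (all outcomes are forgotten at the end). -/
def LOCCProtocol.channel {a' b' : ℕ} : {a b : ℕ} → LOCCProtocol a' b' a b →
    Matrix (Fin a × Fin b) (Fin a × Fin b) ℂ → Matrix (Fin a' × Fin b') (Fin a' × Fin b') ℂ
  | _, _, .done, X => X
  | _, b, .alice _ K _ next, X =>
      ∑ i, (next i).channel
        ((K i ⊗ₖ (1 : Matrix (Fin b) (Fin b) ℂ)) * X * (K i ⊗ₖ (1 : Matrix (Fin b) (Fin b) ℂ))ᴴ)
  | a, _, .bob _ K _ next, X =>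
      ∑ i, (next i).channel
        (((1 : Matrix (Fin a) (Fin a) ℂ) ⊗ₖ K i) * X * ((1 : Matrix (Fin a) (Fin a) ℂ) ⊗ₖ K i)ᴴ)

/-- `σ` can be created from `ρ` by LOCC. -/
def LOCCConvertible {a b a' b' : ℕ} (ρ : Matrix (Fin a × Fin b) (Fin a × Fin b) ℂ)
    (σ : Matrix (Fin a' × Fin b') (Fin a' × Fin b') ℂ) : Prop :=
  ∃ P : LOCCProtocol a' b' a b, P.channel ρ = σ

/-- An entanglement monotone on `ℂ^a ⊗ ℂ^b`: a real function of the bipartite states (values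
outside the set of states are irrelevant) that does not increase under LOCC. -/
def IsEntanglementMonotone {a b : ℕ}
    (E : Matrix (Fin a × Fin b) (Fin a × Fin b) ℂ → ℝ) : Prop :=
  ∀ ρ ∈ states (Fin a × Fin b), ∀ σ ∈ states (Fin a × Fin b),
    LOCCConvertible ρ σ → E σ ≤ E ρ

/-- A strict entanglement monotone: a monotone with `E(Ψ₁) > E(Ψ₂)` for pure states whenever `Ψ₁`
can be turned into `Ψ₂` by LOCC but not vice versa. -/
def IsStrictEntanglementMonotone {a b : ℕ}
    (E : Matrix (Fin a × Fin b) (Fin a × Fin b) ℂ → ℝ) : Prop :=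
  IsEntanglementMonotone E ∧
    ∀ ρ ∈ pureStates (Fin a × Fin b), ∀ σ ∈ pureStates (Fin a × Fin b),
      LOCCConvertible ρ σ → ¬ LOCCConvertible σ ρ → E σ < E ρ

end Masking

end

/-! Write $A(x)$ for the coefficient matrix (rows Bob, columns Alice) of $M x$, $x$ a real vector.
Masking says that $A(x)A(x)^\dagger=\|x\|^2\sigma$ and $A(x)^\dagger A(x)=\|x\|^2\tau$. With
$Q=\sqrt\tau$ one gets $A(x)=V(x)Q$ for all $x$ simultaneously, where $V$ is real-linear and, for
unit $x$, consists of partial isometries with common initial and final projections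
(`exists_isometricFamily`). Polarization gives Clifford-type relations for $V$. Given $u\perp y$,
choose a unit $w$ orthogonal to both, which needs $d\ge 3$; the product of the reflections in $u$
and $w$ then fixes $V(u)$, negates $V(y)$, acts locally and commutes with $Q$. So the encodings of
$x+iy$ and $x-iy$ are locally equivalent (`IsometricFamily.exists_conj`).

Creation: up to a phase every unit vector is $x+iy$ with $x\perp y$. Bob measures with operators
proportional to $(V(x)\pm iV(y))V(u_0)^\dagger$, which are complete because the cross terms cancel;
the outcome $-$ is corrected by the local conjugation. Mixtures are made by randomizing this
measurement, and monotones follow at once.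

Equality: LOCC to a pure target cannot lower the operator norm of the coefficient matrix. If the
encoding of $x+iy$ can return to $\Psi_0$, its norm and that of its conjugate are at most that of
$A(u_0)$, while their Gram matrices average to $\tau$; a top eigenvector of $\tau$ then forces $y=0$
(`eq_zero_of_posSemidef_sub`). Convexity and strictness make every pure state below a multiple of
$\rho$ real, which is impossible for a support of dimension at least two
(`mem_realPureStates_of_forall_le`). -/

noncomputable section

namespace Masking

open scoped RealInnerProductSpace

/-! ### Simultaneous polar decomposition and Clifford relations -/

section PolarDecomposition

variable {m n : Type*}

/-- Square root and pseudo-inverse square root of a positive semidefinite matrix. -/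
theorem exists_sqrt_pseudoInverse [Fintype n] [DecidableEq n] {τ : Matrix n n ℂ} (hτ : τ.PosSemidef) :
    ∃ Q S : Matrix n n ℂ, Qᴴ = Q ∧ Sᴴ = S ∧ Q * Q = τ ∧ S * Q = Q * S ∧ Q * S * Q = Q ∧
      S * Q * S = S ∧ ∀ Z, Commute τ Z → Commute Q Z := by
  have hsa : IsSelfAdjoint τ := hτ.1
  have hc : ∀ f : ℝ → ℝ, ContinuousOn f (spectrum ℝ τ) := fun f =>
    Set.Finite.continuousOn Matrix.finite_real_spectrum f
  have hnn : ∀ x ∈ spectrum ℝ τ, 0 ≤ x := by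
    intro x hx
    rw [hτ.1.spectrum_real_eq_range_eigenvalues] at hx
    obtain ⟨i, rfl⟩ := hx
    exact hτ.eigenvalues_nonneg i
  have hherm : ∀ f : ℝ → ℝ, (cfc f τ)ᴴ = cfc f τ := fun f => (cfc_predicate f τ : IsSelfAdjoint _)
  have hmul : ∀ f g : ℝ → ℝ, cfc f τ * cfc g τ = cfc (fun x => f x * g x) τ := fun f g =>
    (cfc_mul f g τ (hc f) (hc g)).symm
  -- Since `0⁻¹ = 0`, the second function yields the pseudo-inverse of the root, and `S * Q` is the
  -- support projection of `τ`.
  refine ⟨cfc Real.sqrt τ, cfc (fun x => (Real.sqrt x)⁻¹) τ, hherm _, hherm _, ?_, ?_, ?_, ?_,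
    fun Z hZ => hsa.commute_cfc hZ _⟩
  · rw [hmul]
    conv_rhs => rw [← cfc_id ℝ τ hsa]
    exact cfc_congr fun x hx => Real.mul_self_sqrt (hnn x hx)
  · rw [hmul, hmul]
    simp only [mul_comm]
  · rw [hmul, hmul]
    exact cfc_congr fun x _ => mul_inv_mul_cancel _
  · rw [hmul, hmul]
    exact cfc_congr fun x _ => by
      simpa using mul_inv_mul_cancel (Real.sqrt x)⁻¹

theorem mul_eq_zero_of_mul_mul_conjTranspose_eq_zero [Fintype m] [Fintype n]
    {X : Matrix m m ℂ} {A : Matrix m n ℂ}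
    (h : X * (A * Aᴴ) * Xᴴ = 0) : X * A = 0 := by
  rw [← Matrix.self_mul_conjTranspose_eq_zero]
  simpa [Matrix.conjTranspose_mul, Matrix.mul_assoc] using h

theorem mul_eq_zero_of_conjTranspose_mul_mul_eq_zero [Fintype m] [Fintype n]
    {X : Matrix n n ℂ} {A : Matrix m n ℂ}
    (h : Xᴴ * (Aᴴ * A) * X = 0) : A * X = 0 := by
  rw [← Matrix.conjTranspose_mul_self_eq_zero]
  simpa [Matrix.conjTranspose_mul, Matrix.mul_assoc] using h

variable {E : Type*} [NormedAddCommGroup E] [InnerProductSpace ℝ E]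

/-- Expand the hypothesis at `x + y`. For orthogonal vectors the right side vanishes, which is the
anticommutation used below. -/
theorem mul_conjTranspose_polarization [Fintype n] {A : E →ₗ[ℝ] Matrix m n ℂ} {σ : Matrix m m ℂ}
    (h : ∀ x, A x * (A x)ᴴ = (‖x‖ ^ 2) • σ) (x y : E) :
    A x * (A y)ᴴ + A y * (A x)ᴴ = (2 * ⟪x, y⟫) • σ := by
  have h1 := h (x + y)
  rw [norm_add_sq_real, map_add, Matrix.conjTranspose_add, Matrix.add_mul, Matrix.mul_add,
    Matrix.mul_add, h x, h y, add_smul, add_smul] at h1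
  have h2 : A x * (A y)ᴴ + A y * (A x)ᴴ = (‖x‖ ^ 2 • σ + A x * (A y)ᴴ +
    (A y * (A x)ᴴ + ‖y‖ ^ 2 • σ)) - ‖x‖ ^ 2 • σ - ‖y‖ ^ 2 • σ := by abel
  rw [h2, h1]
  abel

theorem conjTranspose_mul_polarization [Fintype m] {A : E →ₗ[ℝ] Matrix m n ℂ} {τ : Matrix n n ℂ}
    (h : ∀ x, (A x)ᴴ * A x = (‖x‖ ^ 2) • τ) (x y : E) :
    (A x)ᴴ * A y + (A y)ᴴ * A x = (2 * ⟪x, y⟫) • τ := by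
  have h1 := h (x + y)
  rw [norm_add_sq_real, map_add, Matrix.conjTranspose_add, Matrix.add_mul, Matrix.mul_add,
    Matrix.mul_add, h x, h y, add_smul, add_smul] at h1
  have h2 : (A x)ᴴ * A y + (A y)ᴴ * A x = (‖x‖ ^ 2 • τ + (A x)ᴴ * A y +
    ((A y)ᴴ * A x + ‖y‖ ^ 2 • τ)) - ‖x‖ ^ 2 • τ - ‖y‖ ^ 2 • τ := by abel
  rw [h2, h1]
  abel

variable [Fintype m] [Fintype n]

/-- A real-linear family of matrices all of whose members `V x` are `‖x‖` times a partial isometry,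
with initial projection `P` and final projection `R` independent of `x`. -/
structure IsometricFamily (V : E →ₗ[ℝ] Matrix m n ℂ) (R : Matrix m m ℂ) (P : Matrix n n ℂ) :
    Prop where
  left : ∀ x, V x * (V x)ᴴ = (‖x‖ ^ 2) • R
  right : ∀ x, (V x)ᴴ * V x = (‖x‖ ^ 2) • P
  left_mul : ∀ x, R * V x = V x
  mul_right : ∀ x, V x * P = V x
  left_conjTranspose : Rᴴ = R
  right_conjTranspose : Pᴴ = P
  left_idem : R * R = R
  right_idem : P * P = P

/-- Simultaneous polar decomposition of a real-linear family with constant marginals. -/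
theorem exists_isometricFamily [DecidableEq m] [DecidableEq n] {A : E →ₗ[ℝ] Matrix m n ℂ}
    {σ : Matrix m m ℂ} {τ : Matrix n n ℂ} (hl : ∀ x, A x * (A x)ᴴ = (‖x‖ ^ 2) • σ)
    (hr : ∀ x, (A x)ᴴ * A x = (‖x‖ ^ 2) • τ) {u₀ : E} (hu₀ : ‖u₀‖ = 1) :
    ∃ (V : E →ₗ[ℝ] Matrix m n ℂ) (R : Matrix m m ℂ) (P Q : Matrix n n ℂ),
      IsometricFamily V R P ∧ (∀ x, V x * Q = A x) ∧
      ∀ u w, ‖u‖ = 1 → ‖w‖ = 1 → Commute Q ((V w)ᴴ * V u) := by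
  have hl1 : ∀ u, ‖u‖ = 1 → A u * (A u)ᴴ = σ := fun u hu => by simp [hl, hu]
  have hr1 : ∀ u, ‖u‖ = 1 → (A u)ᴴ * A u = τ := fun u hu => by simp [hr, hu]
  have hτ : τ.PosSemidef := hr1 u₀ hu₀ ▸ Matrix.posSemidef_conjTranspose_mul_self _
  obtain ⟨Q, S, hQ, hS, hQQ, hSQ, hQSQ, hSQS, hcomm⟩ := exists_sqrt_pseudoInverse hτ
  have hPh : (S * Q)ᴴ = S * Q := by rw [Matrix.conjTranspose_mul, hQ, hS, hSQ]
  have hτP : τ * (S * Q) = τ := by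
    rw [← hQQ, Matrix.mul_assoc, ← Matrix.mul_assoc Q S Q, hQSQ]
  have hSτ : S * τ = τ * S := by
    rw [← hQQ, ← Matrix.mul_assoc, hSQ, Matrix.mul_assoc, hSQ, Matrix.mul_assoc]
  have hSτS : S * τ * S = S * Q := by
    rw [← hQQ, ← Matrix.mul_assoc, Matrix.mul_assoc, ← hSQ, ← Matrix.mul_assoc, hSQS]
  have hAP : ∀ x, A x * (S * Q) = A x := by
    intro x
    have : A x * (1 - S * Q) = 0 := by
      apply mul_eq_zero_of_conjTranspose_mul_mul_eq_zero
      rw [hr, Matrix.mul_assoc, Matrix.smul_mul, Matrix.mul_sub, hτP]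
      simp
    rw [Matrix.mul_sub, Matrix.mul_one, sub_eq_zero] at this
    exact this.symm
  -- The polar factor stays linear in `x` because the pseudo-inverse `S` is the same for every `x`.
  let V : E →ₗ[ℝ] Matrix m n ℂ :=
    { toFun := fun x => A x * S
      map_add' := fun x y => by rw [map_add, Matrix.add_mul]
      map_smul' := fun r x => by rw [map_smul, Matrix.smul_mul]; rfl }
  have hV : ∀ x, V x = A x * S := fun _ => rfl
  have hVh : ∀ x, (V x)ᴴ = S * (A x)ᴴ := fun x => by
    rw [hV, Matrix.conjTranspose_mul, hS]
  have hVQ : ∀ x, V x * Q = A x := fun x => by rw [hV, Matrix.mul_assoc, hAP]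
  have hVV : ∀ x, (V x)ᴴ * V x = (‖x‖ ^ 2) • (S * Q) := fun x => by
    rw [hV, Matrix.conjTranspose_mul, hS, Matrix.mul_assoc, ← Matrix.mul_assoc (A x)ᴴ, hr,
      Matrix.smul_mul, Matrix.mul_smul, ← Matrix.mul_assoc, hSτS]
  have hVP : ∀ x, V x * (S * Q) = V x := fun x => by
    rw [hV, Matrix.mul_assoc, hSQ, ← Matrix.mul_assoc S, hSQS]
  have hVA : ∀ u, ‖u‖ = 1 → V u * (V u)ᴴ * A u = A u := fun u hu => by
    rw [hVh, hV, Matrix.mul_assoc, Matrix.mul_assoc, Matrix.mul_assoc, hr1 u hu, hSτ,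
      ← Matrix.mul_assoc S, hSτS, hAP]
  -- `V u * (V u)ᴴ` fixes `A u`, hence the support of `σ = A u * (A u)ᴴ`, which contains the range
  -- of every `A x`.
  have habs : ∀ u x, ‖u‖ = 1 → V u * (V u)ᴴ * A x = A x := by
    intro u x hu
    have : (1 - V u * (V u)ᴴ) * A x = 0 := by
      apply mul_eq_zero_of_mul_mul_conjTranspose_eq_zero
      rw [hl, ← hl1 u hu, Matrix.mul_smul, ← Matrix.mul_assoc, Matrix.sub_mul, hVA u hu]
      simp
    rw [Matrix.sub_mul, Matrix.one_mul, sub_eq_zero] at this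
    exact this.symm
  have hRV : ∀ x, V u₀ * (V u₀)ᴴ * V x = V x := fun x => by
    rw [hV x, ← Matrix.mul_assoc, habs u₀ x hu₀]
  have hRu : ∀ u, ‖u‖ = 1 → V u * (V u)ᴴ = V u₀ * (V u₀)ᴴ := by
    intro u hu
    have h1 : V u₀ * (V u₀)ᴴ * (V u * (V u)ᴴ) = V u * (V u)ᴴ := by
      rw [← Matrix.mul_assoc, hRV]
    have h2 : V u * (V u)ᴴ * (V u₀ * (V u₀)ᴴ) = V u₀ * (V u₀)ᴴ := by
      rw [← Matrix.mul_assoc, hV u₀, ← Matrix.mul_assoc, habs u u₀ hu]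
    have h3 := congrArg Matrix.conjTranspose h1
    simp only [Matrix.conjTranspose_mul, Matrix.conjTranspose_conjTranspose] at h3
    exact h3.symm.trans h2
  refine ⟨V, V u₀ * (V u₀)ᴴ, S * Q, Q, ⟨?_, hVV, hRV, hVP, ?_, hPh, ?_, ?_⟩, hVQ, ?_⟩
  · intro x
    by_cases hx : x = 0
    · simp [hx]
    · have hn : ‖x‖ ≠ 0 := norm_ne_zero_iff.2 hx
      have h1 : ‖(‖x‖⁻¹) • x‖ = 1 := by simp [norm_smul, hn]
      rw [← hRu _ h1, map_smul, Matrix.conjTranspose_smul, Matrix.smul_mul, Matrix.mul_smul,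
        smul_smul, smul_smul, star_trivial]
      field_simp
      simp
  · simp
  · rw [← Matrix.mul_assoc, hRV]
  · rw [← Matrix.mul_assoc, hSQS]
  · intro u w hu hw
    -- Each `V u` intertwines `τ` and `σ`, so `(V w)ᴴ * V u` commutes with `τ` and therefore with
    -- its root.
    apply hcomm
    have h1 : V u * τ = σ * V u := by
      rw [hV, Matrix.mul_assoc, hSτ, ← hr1 u hu, ← hl1 u hu]
      simp only [Matrix.mul_assoc]
    have h2 : τ * (V w)ᴴ = (V w)ᴴ * σ := by
      rw [hVh, ← Matrix.mul_assoc, ← hSτ, ← hr1 w hw, ← hl1 w hw]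
      simp only [Matrix.mul_assoc]
    change τ * ((V w)ᴴ * V u) = (V w)ᴴ * V u * τ
    rw [← Matrix.mul_assoc, h2, Matrix.mul_assoc, Matrix.mul_assoc, h1]

namespace IsometricFamily

variable {V : E →ₗ[ℝ] Matrix m n ℂ} {R : Matrix m m ℂ} {P : Matrix n n ℂ}

theorem right_mul_conjTranspose (h : IsometricFamily V R P) (x : E) : P * (V x)ᴴ = (V x)ᴴ := by
  simpa [h.right_conjTranspose] using congrArg Matrix.conjTranspose (h.mul_right x)

/-- Orthogonal directions anticommute. -/
theorem mul_conjTranspose_mul_of_orthogonal (h : IsometricFamily V R P) {u y : E}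
    (huy : ⟪u, y⟫ = 0) (z : E) : V u * ((V y)ᴴ * V z) = -(V y * ((V u)ᴴ * V z)) := by
  have := mul_conjTranspose_polarization h.left u y
  rw [huy, mul_zero, zero_smul] at this
  rw [← Matrix.mul_assoc, eq_neg_of_add_eq_zero_left this, Matrix.neg_mul, Matrix.mul_assoc]

theorem conjTranspose_mul_of_orthogonal (h : IsometricFamily V R P) {u y : E}
    (huy : ⟪u, y⟫ = 0) : (V u)ᴴ * V y = -((V y)ᴴ * V u) := by
  have := conjTranspose_mul_polarization h.right u y
  rw [huy, mul_zero, zero_smul] at this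
  exact eq_neg_of_add_eq_zero_left this

/-- The product of the reflections in `u` and `w` fixes `u`. -/
theorem rotate_self (h : IsometricFamily V R P) {u w : E} (hu : ‖u‖ = 1) (hw : ‖w‖ = 1) :
    V w * (V u)ᴴ * V u * ((V w)ᴴ * V u) = V u := by
  rw [Matrix.mul_assoc (V w), h.right, hu, Matrix.mul_assoc, one_pow, one_smul,
    ← Matrix.mul_assoc P, h.right_mul_conjTranspose, ← Matrix.mul_assoc, h.left, hw, one_pow,
    one_smul, h.left_mul]

/-- The product of the reflections in `u` and `w` negates `y` orthogonal to `u` and `w`. -/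
theorem rotate_orthogonal (h : IsometricFamily V R P) {u w y : E} (hu : ‖u‖ = 1) (hw : ‖w‖ = 1)
    (huw : ⟪u, w⟫ = 0) (huy : ⟪u, y⟫ = 0) (hwy : ⟪w, y⟫ = 0) :
    V w * (V u)ᴴ * V y * ((V w)ᴴ * V u) = -V y := by
  have hyw : ⟪y, w⟫ = 0 := by rw [real_inner_comm]; exact hwy
  rw [Matrix.mul_assoc, h.mul_conjTranspose_mul_of_orthogonal hyw, Matrix.mul_neg,
    Matrix.mul_assoc, ← Matrix.mul_assoc (V u)ᴴ, h.conjTranspose_mul_of_orthogonal huw,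
    Matrix.neg_mul, Matrix.mul_neg, neg_neg, Matrix.mul_assoc, ← Matrix.mul_assoc (V w),
    h.left, hw, one_pow, one_smul, ← Matrix.mul_assoc, h.left_mul,
    h.mul_conjTranspose_mul_of_orthogonal huy, h.right, hu, one_pow, one_smul, h.mul_right]

/-- `V` is only real-linear, so the complex coefficient `c` stays outside; `c = Complex.I` gives
complex conjugation of amplitudes. -/
theorem rotate (h : IsometricFamily V R P) {u w y : E} (hu : ‖u‖ = 1) (hw : ‖w‖ = 1)
    (huw : ⟪u, w⟫ = 0) (huy : ⟪u, y⟫ = 0) (hwy : ⟪w, y⟫ = 0) (r : ℝ) (c : ℂ) :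
    V w * (V u)ᴴ * (V (r • u) + c • V y) * ((V w)ᴴ * V u) = V (r • u) - c • V y := by
  rw [map_smul, Matrix.mul_add, Matrix.add_mul, Matrix.mul_smul, Matrix.smul_mul, Matrix.mul_smul,
    Matrix.smul_mul, h.rotate_self hu hw, h.rotate_orthogonal hu hw huw huy hwy, smul_neg,
    sub_eq_add_neg]

end IsometricFamily

end PolarDecomposition

/-! ### Pure states and rank-one domination -/

section States

variable {ι κ : Type} [Fintype ι]

theorem posSemidef_proj (ψ : ι → ℂ) : (proj ψ).PosSemidef :=
  Matrix.posSemidef_vecMulVec_self_star ψ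

theorem proj_mulVec (N : Matrix κ ι ℂ) (ψ : ι → ℂ) : proj (N *ᵥ ψ) = N * proj ψ * Nᴴ := by
  simp only [proj]
  rw [Matrix.mul_vecMulVec, Matrix.vecMulVec_mul, Matrix.star_mulVec]

theorem trace_proj (ψ : ι → ℂ) : (proj ψ).trace = star ψ ⬝ᵥ ψ := by
  rw [proj, Matrix.trace_vecMulVec, dotProduct_comm]

theorem proj_smul {ι : Type} (c : ℂ) (ψ : ι → ℂ) : proj (c • ψ) = (c * star c) • proj ψ := by
  ext i j
  simp [proj, Matrix.vecMulVec_apply]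
  ring

theorem proj_mul_proj {ψ : ι → ℂ} (h : star ψ ⬝ᵥ ψ = 1) : proj ψ * proj ψ = proj ψ := by
  simp [proj, Matrix.vecMulVec_mul_vecMulVec, h]

theorem proj_mem_pureStates {ψ : ι → ℂ} (h : star ψ ⬝ᵥ ψ = 1) : proj ψ ∈ pureStates ι :=
  ⟨⟨posSemidef_proj ψ, by rw [trace_proj, h]⟩, ψ, rfl⟩

/-- Conjugation by an isometry maps states to states. -/
theorem isometry_mul_mul_mem_states [Fintype κ] [DecidableEq ι] {M : Matrix κ ι ℂ} (hM : Mᴴ * M = 1)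
    {ρ : Matrix ι ι ℂ} (hρ : ρ ∈ states ι) : M * ρ * Mᴴ ∈ states κ := by
  refine ⟨hρ.1.mul_mul_conjTranspose_same M, ?_⟩
  rw [Matrix.trace_mul_comm, ← Matrix.mul_assoc, hM, Matrix.one_mul, hρ.2]

/-- A positive semidefinite matrix below a multiple of a pure state is proportional to it. -/
theorem eq_smul_proj_of_le [DecidableEq ι] {X Y : Matrix ι ι ℂ} {Φ : ι → ℂ} {t : ℝ}
    (hX : X.PosSemidef) (hY : Y.PosSemidef) (hΦ : star Φ ⬝ᵥ Φ = 1) (h : X + Y = t • proj Φ) :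
    ∃ s : ℝ, 0 ≤ s ∧ X = s • proj Φ := by
  have hp : (proj Φ)ᴴ = proj Φ := (posSemidef_proj Φ).1
  have hpp := proj_mul_proj hΦ
  obtain ⟨B, -, hB, -, hBB, -⟩ := exists_sqrt_pseudoInverse hX
  -- Compressed to the complement of `Φ`, the two positive summands add up to zero, so both vanish
  -- there.
  have hsum : (1 - proj Φ)ᴴ * X * (1 - proj Φ) + (1 - proj Φ)ᴴ * Y * (1 - proj Φ) = 0 := by
    rw [← Matrix.add_mul, ← Matrix.mul_add, h, Matrix.mul_assoc, Matrix.smul_mul, Matrix.mul_sub,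
      hpp]
    simp
  have h1 := hX.conjTranspose_mul_mul_same (1 - proj Φ)
  have h2 := hY.conjTranspose_mul_mul_same (1 - proj Φ)
  have h3 : (1 - proj Φ)ᴴ * X * (1 - proj Φ) = 0 := by
    rw [← h1.trace_eq_zero_iff]
    have := congrArg Matrix.trace hsum
    rw [Matrix.trace_add, Matrix.trace_zero] at this
    exact ((add_eq_zero_iff_of_nonneg h1.trace_nonneg h2.trace_nonneg).1 this).1
  have h4 : X * (1 - proj Φ) = 0 := by
    have : B * (1 - proj Φ) = 0 := by
      apply mul_eq_zero_of_conjTranspose_mul_mul_eq_zero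
      rw [hB, hBB, h3]
    rw [← hBB, Matrix.mul_assoc, this, Matrix.mul_zero]
  have h5 : X = X * proj Φ := by
    rwa [Matrix.mul_sub, Matrix.mul_one, sub_eq_zero] at h4
  have h6 : X = proj Φ * X := by
    have := congrArg Matrix.conjTranspose h5
    rwa [Matrix.conjTranspose_mul, hX.1, hp] at this
  have hs := hX.dotProduct_mulVec_nonneg Φ
  have hre : ((star Φ ⬝ᵥ X *ᵥ Φ).re : ℂ) = star Φ ⬝ᵥ X *ᵥ Φ :=
    Complex.ext rfl (Complex.nonneg_iff.1 hs).2
  refine ⟨(star Φ ⬝ᵥ X *ᵥ Φ).re, (Complex.nonneg_iff.1 hs).1, ?_⟩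
  have h7 : X = (star Φ ⬝ᵥ X *ᵥ Φ) • proj Φ := by
    conv_lhs => rw [h6, h5]
    rw [proj, Matrix.mul_vecMulVec, Matrix.vecMulVec_mul_vecMulVec, Matrix.vecMulVec_smul]
  conv_lhs => rw [h7, ← hre]
  rfl

end States

/-! ### Norm bounds for the two Gram matrices -/

section ContractionBound

variable {m n : Type*} [Fintype m] [Fintype n] [DecidableEq m] [DecidableEq n]

/-- For $c>0$ use $(c-TT^\dagger)^2+T(c-T^\dagger T)T^\dagger=c(c-TT^\dagger)$; for $c=0$ the bound
forces $T=0$. -/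
theorem posSemidef_smul_one_sub_self_mul_conjTranspose {c : ℝ} (hc : 0 ≤ c) {T : Matrix m n ℂ}
    (h : (c • (1 : Matrix n n ℂ) - Tᴴ * T).PosSemidef) :
    (c • (1 : Matrix m m ℂ) - T * Tᴴ).PosSemidef := by
  rcases hc.eq_or_lt with rfl | hc
  · rw [zero_smul, zero_sub] at h
    have h1 := Matrix.posSemidef_conjTranspose_mul_self T
    have h2 : Tᴴ * T = 0 := by
      rw [← h1.trace_eq_zero_iff]
      have := h.trace_nonneg
      rw [Matrix.trace_neg, neg_nonneg] at this
      exact le_antisymm this h1.trace_nonneg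
    rw [Matrix.conjTranspose_mul_self_eq_zero] at h2
    simp [h2, Matrix.PosSemidef.zero]
  · have hh : (c • (1 : Matrix m m ℂ) - T * Tᴴ)ᴴ = c • (1 : Matrix m m ℂ) - T * Tᴴ := by
      simp [Matrix.conjTranspose_sub, Matrix.conjTranspose_smul]
    have h1 := (Matrix.posSemidef_conjTranspose_mul_self (c • (1 : Matrix m m ℂ) - T * Tᴴ)).add
      (h.mul_mul_conjTranspose_same T)
    have h2 : (c • (1 : Matrix m m ℂ) - T * Tᴴ)ᴴ * (c • (1 : Matrix m m ℂ) - T * Tᴴ) +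
        T * (c • (1 : Matrix n n ℂ) - Tᴴ * T) * Tᴴ = c • (c • (1 : Matrix m m ℂ) - T * Tᴴ) := by
      rw [hh]
      simp only [Matrix.mul_sub, Matrix.sub_mul, Matrix.smul_mul, Matrix.mul_smul, Matrix.one_mul,
        Matrix.mul_one, smul_sub, Matrix.mul_assoc]
      abel
    rw [h2] at h1
    have h3 := h1.smul (inv_nonneg.2 hc.le)
    rwa [smul_smul, inv_mul_cancel₀ hc.ne', one_smul] at h3

end ContractionBound

/-! ### LOCC protocols on pure states -/

section Protocols

variable {a b a' b' : ℕ}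

/-- `Matrix.vec` stacks columns, so columns belong to Alice and rows to Bob; this causes the
transpose. -/
theorem conjTranspose_mul_self_eq_traceB (T : Matrix (Fin b) (Fin a) ℂ) :
    Tᴴ * T = (traceB (proj T.vec))ᵀ := by
  ext i j
  simp [traceB, proj, Matrix.vecMulVec_apply, Matrix.mul_apply, mul_comm]

theorem mul_conjTranspose_self_eq_traceA (T : Matrix (Fin b) (Fin a) ℂ) :
    T * Tᴴ = traceA (proj T.vec) := by
  ext i j
  simp [traceA, proj, Matrix.vecMulVec_apply, Matrix.mul_apply]

theorem traceB_smul (t : ℝ) (X : Matrix (Fin a × Fin b) (Fin a × Fin b) ℂ) :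
    traceB (t • X) = t • traceB X := by
  ext i j
  simp [traceB, Finset.mul_sum]

theorem sum_kronecker_one_conjTranspose_mul {k : ℕ} {c : Fin k → ℕ}
    {K : ∀ i, Matrix (Fin (c i)) (Fin a) ℂ} (hK : ∑ i, (K i)ᴴ * K i = 1) :
    ∑ i, (K i ⊗ₖ (1 : Matrix (Fin b) (Fin b) ℂ))ᴴ * (K i ⊗ₖ (1 : Matrix (Fin b) (Fin b) ℂ)) = 1 := by
  simp only [Matrix.conjTranspose_kronecker, ← Matrix.mul_kronecker_mul, Matrix.conjTranspose_one,
    Matrix.one_mul]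
  rw [← Matrix.one_kronecker_one, ← hK]
  ext i j
  simp only [Matrix.sum_apply, Matrix.kroneckerMap_apply, Finset.sum_mul]

theorem sum_one_kronecker_conjTranspose_mul {k : ℕ} {c : Fin k → ℕ}
    {K : ∀ i, Matrix (Fin (c i)) (Fin b) ℂ} (hK : ∑ i, (K i)ᴴ * K i = 1) :
    ∑ i, ((1 : Matrix (Fin a) (Fin a) ℂ) ⊗ₖ K i)ᴴ * ((1 : Matrix (Fin a) (Fin a) ℂ) ⊗ₖ K i) = 1 := by
  simp only [Matrix.conjTranspose_kronecker, ← Matrix.mul_kronecker_mul, Matrix.conjTranspose_one,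
    Matrix.one_mul]
  rw [← Matrix.one_kronecker_one, ← hK]
  ext i j
  simp only [Matrix.sum_apply, Matrix.kroneckerMap_apply, Finset.mul_sum]

theorem sum_trace_kraus {ι : Type*} {κ : ℕ → Type*} {n : Type*} [Fintype ι] [Fintype n]
    [∀ k, Fintype (κ k)] [DecidableEq n] {c : ι → ℕ} {N : ∀ i, Matrix (κ (c i)) n ℂ}
    (hN : ∑ i, (N i)ᴴ * N i = 1) (X : Matrix n n ℂ) :
    ∑ i, (N i * X * (N i)ᴴ).trace = X.trace := by
  simp_rw [fun i => Matrix.trace_mul_comm (N i * X) (N i)ᴴ, ← Matrix.mul_assoc]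
  rw [← Matrix.trace_sum, ← Matrix.sum_mul, hN, Matrix.one_mul]

theorem LOCCProtocol.posSemidef_channel (p : LOCCProtocol a' b' a b)
    {X : Matrix (Fin a × Fin b) (Fin a × Fin b) ℂ} (hX : X.PosSemidef) :
    (p.channel X).PosSemidef := by
  induction p with
  | done => exact hX
  | alice c K hK next ih =>
    exact Matrix.posSemidef_sum _ fun i _ => ih i (hX.mul_mul_conjTranspose_same _)
  | bob c K hK next ih =>
    exact Matrix.posSemidef_sum _ fun i _ => ih i (hX.mul_mul_conjTranspose_same _)

theorem LOCCProtocol.trace_channel (p : LOCCProtocol a' b' a b)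
    (X : Matrix (Fin a × Fin b) (Fin a × Fin b) ℂ) : (p.channel X).trace = X.trace := by
  induction p with
  | done => rfl
  | @alice a b k c K hK next ih =>
    simp only [LOCCProtocol.channel, Matrix.trace_sum, ih]
    exact sum_trace_kraus (κ := fun k => Fin k × Fin b) (sum_kronecker_one_conjTranspose_mul hK) X
  | @bob a b k c K hK next ih =>
    simp only [LOCCProtocol.channel, Matrix.trace_sum, ih]
    exact sum_trace_kraus (κ := fun k => Fin a × Fin k) (sum_one_kronecker_conjTranspose_mul hK) X

/-- A possibly trace-decreasing local contraction of Alice, completed to a measurement. -/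
theorem exists_protocol_alice_contraction {U : Matrix (Fin a) (Fin a) ℂ}
    (hU : (1 - Uᴴ * U).PosSemidef) :
    ∃ p : LOCCProtocol a b a b, ∀ X, X.PosSemidef →
      ∃ Y, Y.PosSemidef ∧ p.channel X = (U ⊗ₖ (1 : Matrix (Fin b) (Fin b) ℂ)) * X *
        (U ⊗ₖ (1 : Matrix (Fin b) (Fin b) ℂ))ᴴ + Y := by
  obtain ⟨B, -, hB, -, hBB, -⟩ := exists_sqrt_pseudoInverse hU
  refine ⟨.alice (fun _ : Fin 2 => a) ![U, B] (by simp [hB, hBB]) (fun _ => .done), ?_⟩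
  intro X hX
  exact ⟨_, hX.mul_mul_conjTranspose_same (B ⊗ₖ (1 : Matrix (Fin b) (Fin b) ℂ)), by
    simp [LOCCProtocol.channel]⟩

/-- One round of measurement by Bob followed by local contractions of Alice; since the total trace
is preserved, the outcomes needed to complete the measurements never occur. -/
theorem loccConvertible_of_contractions {ι : Type*} [Fintype ι]
    {K : ι → Matrix (Fin b) (Fin b) ℂ} {U : ι → Matrix (Fin a) (Fin a) ℂ}
    (hK : (1 - ∑ i, (K i)ᴴ * K i).PosSemidef) (hU : ∀ i, (1 - (U i)ᴴ * U i).PosSemidef)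
    {X : Matrix (Fin a × Fin b) (Fin a × Fin b) ℂ} (hX : X.PosSemidef)
    (htr : (∑ i, (U i ⊗ₖ K i) * X * (U i ⊗ₖ K i)ᴴ).trace = X.trace) :
    LOCCConvertible X (∑ i, (U i ⊗ₖ K i) * X * (U i ⊗ₖ K i)ᴴ) := by
  obtain ⟨B, -, hB, -, hBB, -⟩ := exists_sqrt_pseudoInverse hK
  choose p hp using fun i => exists_protocol_alice_contraction (b := b) (hU i)
  let e := Fintype.equivFin ι
  let K' : Fin (Fintype.card ι + 1) → Matrix (Fin b) (Fin b) ℂ := Fin.cons B fun j => K (e.symm j)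
  let next : Fin (Fintype.card ι + 1) → LOCCProtocol a b a b :=
    Fin.cons .done fun j => p (e.symm j)
  have hK' : ∑ i, (K' i)ᴴ * K' i = 1 := by
    rw [Fin.sum_univ_succ]
    simp only [K', Fin.cons_zero, Fin.cons_succ]
    rw [hB, hBB, e.symm.sum_comp (fun i => (K i)ᴴ * K i), sub_add_cancel]
  let q : LOCCProtocol a b a b := .bob (fun _ => b) K' hK' next
  have hXi : ∀ i, (((1 : Matrix (Fin a) (Fin a) ℂ) ⊗ₖ K i) * X *
      ((1 : Matrix (Fin a) (Fin a) ℂ) ⊗ₖ K i)ᴴ).PosSemidef :=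
    fun i => hX.mul_mul_conjTranspose_same _
  choose Y hY hYeq using fun i => hp i _ (hXi i)
  -- `Z` collects every branch in which a completing outcome occurs.
  let Z := ((1 : Matrix (Fin a) (Fin a) ℂ) ⊗ₖ B) * X *
      ((1 : Matrix (Fin a) (Fin a) ℂ) ⊗ₖ B)ᴴ + ∑ i, Y i
  have hZ : Z.PosSemidef :=
    (hX.mul_mul_conjTranspose_same _).add (Matrix.posSemidef_sum _ fun i _ => hY i)
  have hq : q.channel X = ∑ i, (U i ⊗ₖ K i) * X * (U i ⊗ₖ K i)ᴴ + Z := by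
    have h1 : q.channel X = ((1 : Matrix (Fin a) (Fin a) ℂ) ⊗ₖ B) * X *
        ((1 : Matrix (Fin a) (Fin a) ℂ) ⊗ₖ B)ᴴ + ∑ i, (p i).channel
          (((1 : Matrix (Fin a) (Fin a) ℂ) ⊗ₖ K i) * X *
            ((1 : Matrix (Fin a) (Fin a) ℂ) ⊗ₖ K i)ᴴ) := by
      simp only [q, LOCCProtocol.channel]
      rw [Fin.sum_univ_succ]
      simp only [K', next, Fin.cons_zero, Fin.cons_succ]
      rw [e.symm.sum_comp (fun i => (p i).channel (((1 : Matrix (Fin a) (Fin a) ℂ) ⊗ₖ K i) * X *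
        ((1 : Matrix (Fin a) (Fin a) ℂ) ⊗ₖ K i)ᴴ))]
      rfl
    have h2 : ∀ i, (U i ⊗ₖ (1 : Matrix (Fin b) (Fin b) ℂ)) *
        (((1 : Matrix (Fin a) (Fin a) ℂ) ⊗ₖ K i) * X * ((1 : Matrix (Fin a) (Fin a) ℂ) ⊗ₖ K i)ᴴ) *
        (U i ⊗ₖ (1 : Matrix (Fin b) (Fin b) ℂ))ᴴ = (U i ⊗ₖ K i) * X * (U i ⊗ₖ K i)ᴴ := by
      intro i
      have h3 : U i ⊗ₖ K i = (U i ⊗ₖ (1 : Matrix (Fin b) (Fin b) ℂ)) *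
          ((1 : Matrix (Fin a) (Fin a) ℂ) ⊗ₖ K i) := by
        rw [← Matrix.mul_kronecker_mul, Matrix.mul_one, Matrix.one_mul]
      rw [h3, Matrix.conjTranspose_mul]
      simp only [Matrix.mul_assoc]
    rw [h1]
    simp only [hYeq, h2, Finset.sum_add_distrib, Z]
    abel
  refine ⟨q, ?_⟩
  have hZ0 : Z = 0 := by
    rw [← hZ.trace_eq_zero_iff]
    have := q.trace_channel X
    rw [hq, Matrix.trace_add, htr] at this
    simpa using this
  rw [hq, hZ0, add_zero]

/-- A protocol producing the pure state `vec S` cannot decrease the operator norm of the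
coefficient matrix. -/
theorem LOCCProtocol.posSemidef_sub_of_channel_eq {S : Matrix (Fin b') (Fin a') ℂ}
    (hS : star S.vec ⬝ᵥ S.vec = 1) {l : ℝ} (hl : 0 ≤ l)
    (hSl : (l • (1 : Matrix (Fin a') (Fin a') ℂ) - Sᴴ * S).PosSemidef)
    (p : LOCCProtocol a' b' a b) (T : Matrix (Fin b) (Fin a) ℂ) (t : ℝ) (ht : 0 ≤ t)
    (h : p.channel (proj T.vec) = t • proj S.vec) :
    ((t * l) • (1 : Matrix (Fin a) (Fin a) ℂ) - Tᴴ * T).PosSemidef := by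
  -- If positive branches sum to a multiple of a pure state, each is a multiple of it; the weights
  -- `s i` are the branch probabilities fed to the induction.
  have split : ∀ {k : ℕ} (Y : Fin k → Matrix (Fin a' × Fin b') (Fin a' × Fin b') ℂ) (t : ℝ),
      (∀ i, (Y i).PosSemidef) → ∑ i, Y i = t • proj S.vec →
      ∃ s : Fin k → ℝ, (∀ i, 0 ≤ s i) ∧ (∀ i, Y i = s i • proj S.vec) ∧ ∑ i, s i = t := by
    intro k Y t hY hsum
    have : ∀ i, ∃ s : ℝ, 0 ≤ s ∧ Y i = s • proj S.vec := fun i =>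
      eq_smul_proj_of_le (hY i) (Matrix.posSemidef_sum (Finset.univ.erase i) fun j _ => hY j) hS
        ((Finset.add_sum_erase _ _ (Finset.mem_univ i)).trans hsum)
    choose s hs hsY using this
    refine ⟨s, hs, hsY, ?_⟩
    have h1 := congrArg Matrix.trace hsum
    simp only [hsY, Matrix.trace_sum, Matrix.trace_smul, trace_proj, hS] at h1
    rw [← Finset.sum_smul] at h1
    simpa [← Complex.ofReal_sum, -Complex.ofReal_sum] using h1
  induction p generalizing t with
  | done =>
    change proj T.vec = t • proj S.vec at h
    rw [conjTranspose_mul_self_eq_traceB, h, traceB_smul, Matrix.transpose_smul,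
      ← conjTranspose_mul_self_eq_traceB, mul_smul, ← smul_sub]
    exact hSl.smul ht
  | @alice a b k c K hK next ih =>
    simp only [LOCCProtocol.channel, ← proj_mulVec, Matrix.kronecker_mulVec_vec,
      Matrix.one_mul] at h
    obtain ⟨s, hs, hsY, hst⟩ := split _ t (fun i => (next i).posSemidef_channel
      (posSemidef_proj _)) h
    -- Alice turns `T` into `T * (K i)ᵀ`, and completeness of her measurement telescopes only in `T
    -- * Tᴴ`: the bound is flipped, summed and flipped back.
    have h1 := fun i => posSemidef_smul_one_sub_self_mul_conjTranspose (mul_nonneg (hs i) hl)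
      (ih i _ (s i) (hs i) (hsY i))
    have h2 := Matrix.posSemidef_sum Finset.univ fun i _ => h1 i
    have h3 : ∑ i, ((s i * l) • (1 : Matrix (Fin b) (Fin b) ℂ) -
        T * (K i)ᵀ * (T * (K i)ᵀ)ᴴ) = (t * l) • (1 : Matrix (Fin b) (Fin b) ℂ) - T * Tᴴ := by
      rw [Finset.sum_sub_distrib, ← Finset.sum_smul, ← Finset.sum_mul, hst]
      congr 1
      have h4 : ∑ i, (K i)ᵀ * ((K i)ᵀ)ᴴ = 1 := by
        have := congrArg Matrix.transpose hK
        simpa [Matrix.transpose_sum, Matrix.transpose_mul, Matrix.conjTranspose, Matrix.transpose_map] using this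
      simp only [Matrix.conjTranspose_mul, Matrix.mul_assoc]
      rw [← Matrix.mul_sum]
      simp only [← Matrix.mul_assoc]
      rw [← Matrix.sum_mul, h4, Matrix.one_mul]
    rw [h3] at h2
    have h5 := posSemidef_smul_one_sub_self_mul_conjTranspose (T := Tᴴ) (mul_nonneg ht hl)
      (by simpa using h2)
    simpa using h5
  | @bob a b k c K hK next ih =>
    simp only [LOCCProtocol.channel, ← proj_mulVec, Matrix.kronecker_mulVec_vec,
      Matrix.transpose_one, Matrix.mul_one] at h
    obtain ⟨s, hs, hsY, hst⟩ := split _ t (fun i => (next i).posSemidef_channel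
      (posSemidef_proj _)) h
    have h2 := Matrix.posSemidef_sum Finset.univ fun i _ => ih i _ (s i) (hs i) (hsY i)
    have h3 : ∑ i, ((s i * l) • (1 : Matrix (Fin a) (Fin a) ℂ) -
        (K i * T)ᴴ * (K i * T)) = (t * l) • (1 : Matrix (Fin a) (Fin a) ℂ) - Tᴴ * T := by
      rw [Finset.sum_sub_distrib, ← Finset.sum_smul, ← Finset.sum_mul, hst]
      congr 1
      simp only [Matrix.conjTranspose_mul, Matrix.mul_assoc]
      rw [← Matrix.mul_sum]
      simp only [← Matrix.mul_assoc]
      rw [← Matrix.sum_mul, hK, Matrix.one_mul]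
    rwa [h3] at h2

end Protocols

/-! ### Local conjugation, creation of pure states, rigidity of the norm -/

section LocalOperations

variable {m n : Type*} [Fintype m] [Fintype n]
variable {E : Type*} [NormedAddCommGroup E] [InnerProductSpace ℝ E]

theorem posSemidef_one_sub_of_idem [DecidableEq n] {P : Matrix n n ℂ} (hP : Pᴴ = P) (hPP : P * P = P) :
    (1 - P).PosSemidef := by
  have := Matrix.posSemidef_conjTranspose_mul_self (1 - P)
  have h : (1 - P)ᴴ * (1 - P) = 1 - P := by
    rw [Matrix.conjTranspose_sub, hP, Matrix.conjTranspose_one, Matrix.mul_sub, Matrix.sub_mul,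
      Matrix.sub_mul, hPP]
    simp
  rwa [h] at this

/-- The cross terms cancel. This gives both the completeness of Bob's measurement and the average
`τ` in the norm argument. -/
theorem gram_add_I_smul_add_gram_sub_I_smul {m n : Type*} [Fintype m] (Z W : Matrix m n ℂ) :
    (Z + Complex.I • W)ᴴ * (Z + Complex.I • W) + (Z - Complex.I • W)ᴴ * (Z - Complex.I • W) =
      (2 : ℝ) • (Zᴴ * Z + Wᴴ * W) := by
  simp only [Matrix.conjTranspose_add, Matrix.conjTranspose_sub, Matrix.conjTranspose_smul,
    Matrix.add_mul, Matrix.sub_mul, Matrix.mul_sub, Matrix.mul_add, Matrix.smul_mul,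
    Matrix.mul_smul]
  ext i j
  simp only [Matrix.add_apply, Matrix.sub_apply, Matrix.smul_apply, smul_eq_mul, Complex.star_def,
    Complex.conj_I, Complex.real_smul]
  push_cast
  linear_combination (-2 * (Wᴴ * W) i j) * Complex.I_sq

/-- The place where dimension at least three is essential: `w` is the auxiliary axis of the double
reflection. -/
theorem exists_unit_orthogonal_pair (hE : 3 ≤ Module.finrank ℝ E) (x y : E) :
    ∃ w : E, ‖w‖ = 1 ∧ ⟪x, w⟫ = 0 ∧ ⟪w, y⟫ = 0 := by
  have : FiniteDimensional ℝ E := FiniteDimensional.of_finrank_pos (by omega)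
  classical
  let s : Submodule ℝ E := Submodule.span ℝ (({x, y} : Finset E) : Set E)
  have hs : Module.finrank ℝ s ≤ 2 :=
    (finrank_span_finset_le_card (R := ℝ) ({x, y} : Finset E)).trans Finset.card_le_two
  have hne : sᗮ ≠ ⊥ := by
    intro h
    have := s.finrank_add_finrank_orthogonal
    rw [h, finrank_bot] at this
    omega
  obtain ⟨w, hw, hw0⟩ := Submodule.exists_mem_ne_zero_of_ne_bot hne
  have hxs : x ∈ s := Submodule.subset_span (by simp)
  have hys : y ∈ s := Submodule.subset_span (by simp)
  refine ⟨(‖w‖⁻¹) • w, by simp [norm_smul, hw0], ?_, ?_⟩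
  · rw [inner_smul_right, (Submodule.mem_orthogonal s w).1 hw x hxs, mul_zero]
  · rw [real_inner_smul_left, real_inner_comm, (Submodule.mem_orthogonal s w).1 hw y hys, mul_zero]

/-- Complex conjugation of the amplitudes `x + i y` is implemented by local contractions. -/
theorem IsometricFamily.exists_conj {V : E →ₗ[ℝ] Matrix m n ℂ} {R : Matrix m m ℂ}
    {P Q : Matrix n n ℂ} (h : IsometricFamily V R P)
    (hQ : ∀ u w, ‖u‖ = 1 → ‖w‖ = 1 → Commute Q ((V w)ᴴ * V u))
    (hE : 3 ≤ Module.finrank ℝ E) {x y : E} (hx : x ≠ 0) (hxy : ⟪x, y⟫ = 0) :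
    ∃ (X : Matrix m m ℂ) (Y : Matrix n n ℂ), Xᴴ * X = R ∧ Y * Yᴴ = P ∧ Yᴴ * Y = P ∧
      Commute Q Y ∧ ∀ c : ℂ, X * (V x + c • V y) * Y = V x - c • V y := by
  have hn : ‖x‖ ≠ 0 := norm_ne_zero_iff.2 hx
  have hu : ‖(‖x‖⁻¹) • x‖ = 1 := by simp [norm_smul, hn]
  have hxu : ‖x‖ • (‖x‖⁻¹) • x = x := smul_inv_smul₀ hn x
  generalize (‖x‖⁻¹) • x = u at hu hxu
  have huy : ⟪u, y⟫ = 0 := by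
    rw [← hxu, real_inner_smul_left] at hxy
    exact (mul_eq_zero.1 hxy).resolve_left hn
  obtain ⟨w, hw, huw, hwy⟩ := exists_unit_orthogonal_pair hE u y
  refine ⟨V w * (V u)ᴴ, (V w)ᴴ * V u, ?_, ?_, ?_, hQ u w hu hw, ?_⟩
  · rw [Matrix.conjTranspose_mul, Matrix.conjTranspose_conjTranspose, Matrix.mul_assoc,
      ← Matrix.mul_assoc (V w)ᴴ, h.right, hw, one_pow, one_smul, h.right_mul_conjTranspose,
      h.left, hu, one_pow, one_smul]
  · rw [Matrix.conjTranspose_mul, Matrix.conjTranspose_conjTranspose, Matrix.mul_assoc,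
      ← Matrix.mul_assoc (V u), h.left, hu, one_pow, one_smul, h.left_mul,
      h.right, hw, one_pow, one_smul]
  · rw [Matrix.conjTranspose_mul, Matrix.conjTranspose_conjTranspose, Matrix.mul_assoc,
      ← Matrix.mul_assoc (V w), h.left, hw, one_pow, one_smul, h.left_mul,
      h.right, hu, one_pow, one_smul]
  · intro c
    have := h.rotate hu hw huw huy hwy ‖x‖ c
    rwa [hxu] at this

variable [DecidableEq m] [DecidableEq n]

/-- Every `A x + i A y` with `x ⊥ y` arises from `A u₀` by a two-outcome measurement on one side,
followed by contractions on the other side. -/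
theorem exists_local_operations {A : E →ₗ[ℝ] Matrix m n ℂ}
    {σ : Matrix m m ℂ} {τ : Matrix n n ℂ} (hl : ∀ x, A x * (A x)ᴴ = (‖x‖ ^ 2) • σ)
    (hr : ∀ x, (A x)ᴴ * A x = (‖x‖ ^ 2) • τ) (hE : 3 ≤ Module.finrank ℝ E)
    {u₀ : E} (hu₀ : ‖u₀‖ = 1) :
    ∃ R : Matrix m m ℂ, (1 - R).PosSemidef ∧ ∀ x y, ⟪x, y⟫ = 0 → x ≠ 0 →
      ∃ (K : Fin 2 → Matrix m m ℂ) (Y : Fin 2 → Matrix n n ℂ),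
        (∀ s, K s * A u₀ * Y s = A x + Complex.I • A y) ∧
        ∑ s, (K s)ᴴ * K s = (2 * (‖x‖ ^ 2 + ‖y‖ ^ 2)) • R ∧
        ∀ s, (1 - Y s * (Y s)ᴴ).PosSemidef := by
  obtain ⟨V, R, P, Q, hV, hVQ, hQ⟩ := exists_isometricFamily hl hr hu₀
  refine ⟨R, posSemidef_one_sub_of_idem hV.left_conjTranspose hV.left_idem, ?_⟩
  intro x y hxy hx
  obtain ⟨X, Y, hX, hY, -, hQY, hXY⟩ := hV.exists_conj hQ hE hx hxy
  have hKA : ∀ c : ℂ, (V x + c • V y) * (V u₀)ᴴ * A u₀ = A x + c • A y := by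
    intro c
    rw [← hVQ u₀, Matrix.mul_assoc, ← Matrix.mul_assoc (V u₀)ᴴ, hV.right, hu₀, one_pow, one_smul,
      ← Matrix.mul_assoc, Matrix.add_mul, Matrix.smul_mul, hV.mul_right, hV.mul_right,
      Matrix.add_mul, Matrix.smul_mul, hVQ, hVQ]
  -- The second outcome yields the conjugate amplitudes; Bob's half `X` of the correction is
  -- absorbed into his operator, the half `Y` is left to Alice.
  refine ⟨![(V x + Complex.I • V y) * (V u₀)ᴴ, X * ((V x + (-Complex.I) • V y) * (V u₀)ᴴ)],
    ![1, Y], ?_, ?_, ?_⟩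
  · rw [Fin.forall_fin_two]
    refine ⟨by simp [hKA], ?_⟩
    simp only [Matrix.cons_val_one, Matrix.cons_val_fin_one]
    rw [Matrix.mul_assoc X, hKA, ← hVQ x, ← hVQ y, ← Matrix.smul_mul, ← Matrix.add_mul,
      ← Matrix.mul_assoc, Matrix.mul_assoc, hQY.eq, ← Matrix.mul_assoc, hXY, neg_smul, sub_neg_eq_add,
      Matrix.add_mul, Matrix.smul_mul]
  · have hRW : ∀ c : ℂ, R * (V x + c • V y) = V x + c • V y := fun c => by
      rw [Matrix.mul_add, Matrix.mul_smul, hV.left_mul, hV.left_mul]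
    have h1 : ∀ Z : Matrix m n ℂ, (Z * (V u₀)ᴴ)ᴴ * (Z * (V u₀)ᴴ) = V u₀ * (Zᴴ * Z) * (V u₀)ᴴ := by
      intro Z
      simp only [Matrix.conjTranspose_mul, Matrix.conjTranspose_conjTranspose, Matrix.mul_assoc]
    have h2 : (X * ((V x + (-Complex.I) • V y) * (V u₀)ᴴ))ᴴ *
        (X * ((V x + (-Complex.I) • V y) * (V u₀)ᴴ)) =
        V u₀ * ((V x + (-Complex.I) • V y)ᴴ * (V x + (-Complex.I) • V y)) * (V u₀)ᴴ := by
      rw [Matrix.conjTranspose_mul X, Matrix.mul_assoc, ← Matrix.mul_assoc Xᴴ, hX,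
        ← Matrix.mul_assoc R, hRW, h1]
    have h3 : (V x + Complex.I • V y)ᴴ * (V x + Complex.I • V y) +
        (V x + (-Complex.I) • V y)ᴴ * (V x + (-Complex.I) • V y) =
        (2 * (‖x‖ ^ 2 + ‖y‖ ^ 2)) • P := by
      rw [neg_smul, ← sub_eq_add_neg, gram_add_I_smul_add_gram_sub_I_smul, hV.right, hV.right,
        ← add_smul, smul_smul]
    rw [Fin.sum_univ_two]
    simp only [Matrix.cons_val_zero, Matrix.cons_val_one, Matrix.cons_val_fin_one]
    rw [h1, h2, ← Matrix.add_mul, ← Matrix.mul_add, h3, Matrix.mul_smul, Matrix.smul_mul,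
      hV.mul_right, hV.left, hu₀, one_pow, one_smul]
  · rw [Fin.forall_fin_two]
    refine ⟨by simp [Matrix.PosSemidef.zero], ?_⟩
    simp only [Matrix.cons_val_one, Matrix.cons_val_fin_one, hY]
    exact posSemidef_one_sub_of_idem hV.right_conjTranspose hV.right_idem

/-- The largest eigenvalue of a nonzero positive semidefinite matrix, with an eigenvector. -/
theorem exists_top_eigenvector {n : Type*} [Fintype n] [DecidableEq n] {τ : Matrix n n ℂ} (hτ : τ.PosSemidef) (h0 : τ ≠ 0) :
    ∃ (l : ℝ) (e : n → ℂ), 0 < l ∧ e ≠ 0 ∧ τ *ᵥ e = (l : ℂ) • e ∧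
      (l • (1 : Matrix n n ℂ) - τ).PosSemidef := by
  have : Nonempty n := by
    by_contra hn
    rw [not_nonempty_iff] at hn
    exact h0 (Subsingleton.elim _ _)
  obtain ⟨i, hi⟩ := Finite.exists_max hτ.1.eigenvalues
  refine ⟨hτ.1.eigenvalues i, hτ.1.eigenvectorBasis i, ?_, ?_, ?_, ?_⟩
  · refine lt_of_le_of_ne (hτ.eigenvalues_nonneg i) fun h => h0 ?_
    rw [← hτ.1.eigenvalues_eq_zero_iff]
    ext j
    exact le_antisymm ((hi j).trans h.symm.le) (hτ.eigenvalues_nonneg j)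
  · intro h
    have := hτ.1.eigenvectorBasis.orthonormal.ne_zero i
    exact this (by ext j; exact congrFun h j)
  · rw [hτ.1.mulVec_eigenvectorBasis]
    rfl
  · let U : Matrix n n ℂ := (hτ.1.eigenvectorUnitary : Matrix n n ℂ)
    have h1 : τ = U * Matrix.diagonal (fun j => (hτ.1.eigenvalues j : ℂ)) * Uᴴ := by
      conv_lhs => rw [hτ.1.spectral_theorem]
      rfl
    have h2 : U * Uᴴ = 1 := Unitary.coe_mul_star_self hτ.1.eigenvectorUnitary
    have h3 : hτ.1.eigenvalues i • (1 : Matrix n n ℂ) - τ =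
        U * Matrix.diagonal (fun j => ((hτ.1.eigenvalues i - hτ.1.eigenvalues j : ℝ) : ℂ)) * Uᴴ := by
      have : Matrix.diagonal (fun j => ((hτ.1.eigenvalues i - hτ.1.eigenvalues j : ℝ) : ℂ)) =
          hτ.1.eigenvalues i • (1 : Matrix n n ℂ) -
          Matrix.diagonal (fun j => (hτ.1.eigenvalues j : ℂ)) := by
        ext j k
        by_cases hjk : j = k <;> simp [hjk]
      rw [this, Matrix.mul_sub, Matrix.sub_mul, ← h1, Matrix.mul_smul, Matrix.mul_one,
        Matrix.smul_mul, h2]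
    rw [h3]
    refine Matrix.PosSemidef.mul_mul_conjTranspose_same (Matrix.PosSemidef.diagonal fun j => ?_) U
    simpa using hi j

/-- If the operator norm of `A x + i A y` does not exceed that of the real members of the family,
then `y = 0`. -/
theorem eq_zero_of_posSemidef_sub {A : E →ₗ[ℝ] Matrix m n ℂ}
    {σ : Matrix m m ℂ} {τ : Matrix n n ℂ} (hl : ∀ x, A x * (A x)ᴴ = (‖x‖ ^ 2) • σ)
    (hr : ∀ x, (A x)ᴴ * A x = (‖x‖ ^ 2) • τ) (hE : 3 ≤ Module.finrank ℝ E)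
    {x y : E} (hxy : ⟪x, y⟫ = 0) (hx : x ≠ 0) (hnorm : ‖x‖ ^ 2 + ‖y‖ ^ 2 = 1)
    {l : ℝ} {e : n → ℂ} (hl0 : 0 < l) (he : e ≠ 0) (hτe : τ *ᵥ e = (l : ℂ) • e)
    (h : (l • (1 : Matrix n n ℂ) - (A x + Complex.I • A y)ᴴ * (A x + Complex.I • A y)).PosSemidef) :
    y = 0 := by
  have hn : ‖x‖ ≠ 0 := norm_ne_zero_iff.2 hx
  have hu : ‖(‖x‖⁻¹) • x‖ = 1 := by simp [norm_smul, hn]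
  obtain ⟨V, R, P, Q, hV, hVQ, hQ⟩ := exists_isometricFamily hl hr hu
  obtain ⟨X, Y, hX, -, hY, hQY, hXY⟩ := hV.exists_conj hQ hE hx hxy
  set B := A x + Complex.I • A y with hB
  set B' := A x - Complex.I • A y with hB'
  have hconj : X * B * Y = B' := by
    rw [hB, hB', ← hVQ x, ← hVQ y, ← Matrix.smul_mul, ← Matrix.add_mul, ← Matrix.sub_mul,
      ← hXY Complex.I, Matrix.mul_assoc, Matrix.mul_assoc, hQY.eq]
    simp only [Matrix.mul_assoc]
  have h' : (l • (1 : Matrix n n ℂ) - B'ᴴ * B').PosSemidef := by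
    have h1 := (posSemidef_one_sub_of_idem hV.right_conjTranspose hV.right_idem).smul hl0.le
    have h2 := h.conjTranspose_mul_mul_same Y
    have h3 := (posSemidef_one_sub_of_idem hV.left_conjTranspose
      hV.left_idem).conjTranspose_mul_mul_same (B * Y)
    have h4 := (h1.add h2).add h3
    -- The bound passes to the conjugate `B'` as a sum of three positive terms, using `Xᴴ * X = R`
    -- and `Yᴴ * Y = P`.
    have h5 : l • (1 - P) + Yᴴ * (l • (1 : Matrix n n ℂ) - Bᴴ * B) * Y +
        (B * Y)ᴴ * (1 - R) * (B * Y) = l • (1 : Matrix n n ℂ) - B'ᴴ * B' := by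
      rw [← hconj, ← hX, ← hY]
      simp only [Matrix.conjTranspose_mul, Matrix.mul_sub, Matrix.sub_mul, Matrix.mul_smul,
        Matrix.smul_mul, Matrix.mul_one, smul_sub, Matrix.mul_assoc]
      abel
    rwa [h5] at h4
  have hsum : Bᴴ * B + B'ᴴ * B' = (2 : ℝ) • τ := by
    rw [hB, hB', gram_add_I_smul_add_gram_sub_I_smul, hr, hr, ← add_smul, hnorm, one_smul]
  have hsub : (l • (1 : Matrix n n ℂ) - Bᴴ * B) *ᵥ e + (l • (1 : Matrix n n ℂ) - B'ᴴ * B') *ᵥ e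
      = 0 := by
    rw [← Matrix.add_mulVec]
    have : l • (1 : Matrix n n ℂ) - Bᴴ * B + (l • (1 : Matrix n n ℂ) - B'ᴴ * B') =
        (2 : ℝ) • (l • (1 : Matrix n n ℂ) - τ) := by
      rw [smul_sub, ← hsum, two_smul]
      abel
    rw [this, Matrix.smul_mulVec, Matrix.sub_mulVec, hτe, Matrix.smul_mulVec, Matrix.one_mulVec]
    ext j
    simp
  -- The two positive forms sum to `2 (l - τ)`, which annihilates `e`; hence each annihilates `e`.
  have hz : star e ⬝ᵥ (l • (1 : Matrix n n ℂ) - Bᴴ * B) *ᵥ e = 0 := by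
    have h1 := congrArg (fun v => star e ⬝ᵥ v) hsub
    simp only [dotProduct_add, dotProduct_zero] at h1
    exact ((add_eq_zero_iff_of_nonneg (h.dotProduct_mulVec_nonneg e)
      (h'.dotProduct_mulVec_nonneg e)).1 h1).1
  have h1 : (l • (1 : Matrix n n ℂ) - Bᴴ * B) *ᵥ e = 0 := (h.dotProduct_mulVec_zero_iff e).1 hz
  have h2 : (l • (1 : Matrix n n ℂ) - B'ᴴ * B') *ᵥ e = 0 := by simpa [h1] using hsub
  have h3 : (B'ᴴ * B' - Bᴴ * B) *ᵥ e = 0 := by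
    have : B'ᴴ * B' - Bᴴ * B = (l • (1 : Matrix n n ℂ) - Bᴴ * B) -
      (l • (1 : Matrix n n ℂ) - B'ᴴ * B') := by abel
    rw [this, Matrix.sub_mulVec, h1, h2, sub_zero]
  have h4 : B'ᴴ * B' - Bᴴ * B = (-4 * Complex.I) • ((A x)ᴴ * A y) := by
    have hp := conjTranspose_mul_polarization hr x y
    rw [hxy, mul_zero, zero_smul] at hp
    have hp' := eq_neg_of_add_eq_zero_right hp
    rw [hB, hB']
    simp only [Matrix.conjTranspose_add, Matrix.conjTranspose_sub, Matrix.conjTranspose_smul,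
      Matrix.add_mul, Matrix.sub_mul, Matrix.mul_sub,
      Matrix.mul_add, Matrix.smul_mul, Matrix.mul_smul, hp']
    ext i j
    simp
    ring
  have h5 : A x *ᵥ ((A x)ᴴ * A y) *ᵥ e = 0 := by
    rw [h4, Matrix.smul_mulVec, smul_eq_zero] at h3
    rw [h3.resolve_left (by simp), Matrix.mulVec_zero]
  by_contra hy
  have hny : ‖y‖ ≠ 0 := norm_ne_zero_iff.2 hy
  have h6 : σ *ᵥ A y *ᵥ e = 0 := by
    rw [Matrix.mulVec_mulVec, ← Matrix.mul_assoc, hl, Matrix.smul_mul, Matrix.smul_mulVec,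
      smul_eq_zero] at h5
    rw [Matrix.mulVec_mulVec]
    exact h5.resolve_left (by positivity)
  -- Associativity of `A y * (A y)ᴴ * A y` gives `σ * A y = A y * τ`, up to the factor `‖y‖ ^ 2`.
  have h7 : A y *ᵥ τ *ᵥ e = 0 := by
    have : (‖y‖ ^ 2) • (A y *ᵥ τ *ᵥ e) = (‖y‖ ^ 2) • (σ *ᵥ A y *ᵥ e) := by
      rw [← Matrix.smul_mulVec, ← Matrix.smul_mulVec, ← hl]
      rw [Matrix.mulVec_mulVec, Matrix.mulVec_mulVec, Matrix.smul_mul, ← Matrix.mul_smul, ← hr,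
        Matrix.mul_assoc]
    rw [h6, smul_zero, smul_eq_zero] at this
    exact this.resolve_left (by positivity)
  have h8 : A y *ᵥ e = 0 := by
    rw [hτe, Matrix.mulVec_smul, smul_eq_zero] at h7
    exact h7.resolve_left (by exact_mod_cast hl0.ne')
  have h9 : (‖y‖ ^ 2) • (τ *ᵥ e) = 0 := by
    rw [← Matrix.smul_mulVec, ← hr, ← Matrix.mulVec_mulVec, h8, Matrix.mulVec_zero]
  rw [hτe, smul_eq_zero, smul_eq_zero] at h9
  rcases h9 with h9 | h9 | h9
  · exact hny (by simpa using h9)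
  · exact hl0.ne' (by exact_mod_cast h9)
  · exact he h9

end LocalOperations

/-! ### Real and imaginary parts of state vectors -/

section RealAndImaginaryParts

variable {d : ℕ}

/-- The complex vector `x + i y`. -/
def complexVec (x y : EuclideanSpace ℝ (Fin d)) : Fin d → ℂ :=
  fun j => (x j : ℂ) + Complex.I * (y j : ℂ)

theorem star_dotProduct_complexVec (x y : EuclideanSpace ℝ (Fin d)) :
    star (complexVec x y) ⬝ᵥ complexVec x y = ((‖x‖ ^ 2 + ‖y‖ ^ 2 : ℝ) : ℂ) := by
  rw [EuclideanSpace.real_norm_sq_eq, EuclideanSpace.real_norm_sq_eq, ← Finset.sum_add_distrib]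
  push_cast
  refine Finset.sum_congr rfl fun j _ => ?_
  simp only [complexVec, Pi.star_apply, Complex.star_def, map_add, map_mul, Complex.conj_ofReal,
    Complex.conj_I]
  linear_combination (-(y j : ℂ) ^ 2) * Complex.I_sq

/-- Making this sum real and nonnegative by a phase yields both orthogonality of the parts and `‖y‖
≤ ‖x‖`. -/
theorem sum_complexVec_sq (x y : EuclideanSpace ℝ (Fin d)) :
    ∑ j, complexVec x y j ^ 2 = ((‖x‖ ^ 2 - ‖y‖ ^ 2 : ℝ) : ℂ) + Complex.I * (2 * ⟪x, y⟫ : ℝ) := by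
  rw [EuclideanSpace.real_norm_sq_eq, EuclideanSpace.real_norm_sq_eq, PiLp.inner_apply]
  push_cast
  rw [← Finset.sum_sub_distrib, Finset.mul_sum, Finset.mul_sum, ← Finset.sum_add_distrib]
  refine Finset.sum_congr rfl fun j _ => ?_
  simp only [complexVec, RCLike.inner_apply, conj_trivial, Complex.ofReal_mul]
  linear_combination ((y j : ℂ) ^ 2) * Complex.I_sq

/-- Up to a phase, a unit vector is `x + i y` with `x` and `y` orthogonal and `x ≠ 0`. -/
theorem exists_orthogonal_parts {ψ : Fin d → ℂ} (hψ : star ψ ⬝ᵥ ψ = 1) :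
    ∃ x y : EuclideanSpace ℝ (Fin d), ⟪x, y⟫ = 0 ∧ x ≠ 0 ∧ ‖x‖ ^ 2 + ‖y‖ ^ 2 = 1 ∧
      proj ψ = proj (complexVec x y) := by
  set z := ∑ j, ψ j ^ 2 with hz
  -- Half the argument, because the phase enters `z` squared.
  set c := Complex.exp (-(z.arg / 2 : ℝ) * Complex.I) with hc
  have hcc : c * star c = 1 := by
    rw [Complex.star_def, Complex.mul_conj, Complex.normSq_eq_norm_sq, hc, ← Complex.ofReal_neg,
      Complex.norm_exp_ofReal_mul_I]
    simp
  have hcz : c ^ 2 * z = (‖z‖ : ℂ) := by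
    conv_lhs => rw [← Complex.norm_mul_exp_arg_mul_I z]
    rw [hc, ← Complex.exp_nat_mul, mul_left_comm, ← Complex.exp_add]
    have : ((2 : ℕ) : ℂ) * (-((z.arg / 2 : ℝ) : ℂ) * Complex.I) + z.arg * Complex.I = 0 := by
      push_cast
      ring
    rw [this, Complex.exp_zero, mul_one]
  let x : EuclideanSpace ℝ (Fin d) := WithLp.toLp 2 fun j => (c * ψ j).re
  let y : EuclideanSpace ℝ (Fin d) := WithLp.toLp 2 fun j => (c * ψ j).im
  have hxy : complexVec x y = c • ψ := by
    ext j
    simp only [complexVec, x, y, Pi.smul_apply, smul_eq_mul]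
    rw [mul_comm Complex.I]
    exact Complex.re_add_im _
  have hproj : proj ψ = proj (complexVec x y) := by
    rw [hxy, proj_smul, hcc, one_smul]
  have hnorm : ‖x‖ ^ 2 + ‖y‖ ^ 2 = 1 := by
    have h1 := star_dotProduct_complexVec x y
    rw [← trace_proj, ← hproj, trace_proj, hψ] at h1
    exact_mod_cast h1.symm
  have hsq : ((‖x‖ ^ 2 - ‖y‖ ^ 2 : ℝ) : ℂ) + Complex.I * (2 * ⟪x, y⟫ : ℝ) = (‖z‖ : ℂ) := by
    rw [← sum_complexVec_sq, hxy, ← hcz, hz, Finset.mul_sum]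
    simp [mul_pow]
  have him : ⟪x, y⟫ = 0 := by
    have := congrArg Complex.im hsq
    simp only [Complex.add_im, Complex.ofReal_im, Complex.I_mul_im, Complex.ofReal_re] at this
    linarith
  have hre : ‖x‖ ^ 2 - ‖y‖ ^ 2 = ‖z‖ := by
    have := congrArg Complex.re hsq
    simpa only [Complex.add_re, Complex.ofReal_re, Complex.I_mul_re, Complex.ofReal_im, neg_zero,
      add_zero] using this
  refine ⟨x, y, him, ?_, hnorm, hproj⟩
  intro hx
  rw [hx, norm_zero] at hre hnorm
  have := norm_nonneg z
  linarith

theorem proj_complexVec_zero_im (x : EuclideanSpace ℝ (Fin d)) (i j : Fin d) :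
    (proj (complexVec x 0) i j).im = 0 := by
  simp [proj, complexVec, Matrix.vecMulVec_apply]

/-- A real pure state is the projection onto a real unit vector. -/
theorem exists_real_vector_of_im_eq_zero {ψ : Fin d → ℂ} (hψ : star ψ ⬝ᵥ ψ = 1)
    (him : ∀ i j, (proj ψ i j).im = 0) :
    ∃ x : EuclideanSpace ℝ (Fin d), ‖x‖ = 1 ∧ proj ψ = proj (complexVec x 0) := by
  obtain ⟨x, y, hxy, hx, hnorm, hproj⟩ := exists_orthogonal_parts hψ
  -- Reality of the projector makes `x` and `y` parallel; being orthogonal with `x ≠ 0`, they force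
  -- `y = 0`.
  have hsymm : ∀ i j, y i * x j = x i * y j := by
    intro i j
    have h1 := him i j
    rw [hproj] at h1
    simp [proj, complexVec, Matrix.vecMulVec_apply] at h1
    linarith
  have hy : y = 0 := by
    ext i
    have h1 : y i * ‖x‖ ^ 2 = x i * ⟪x, y⟫ := by
      rw [EuclideanSpace.real_norm_sq_eq, PiLp.inner_apply, Finset.mul_sum, Finset.mul_sum]
      refine Finset.sum_congr rfl fun j _ => ?_
      simp only [RCLike.inner_apply, conj_trivial]
      linear_combination x j * hsymm i j
    rw [hxy, mul_zero] at h1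
    have hn : ‖x‖ ≠ 0 := norm_ne_zero_iff.2 hx
    exact (mul_eq_zero.1 h1).resolve_right (by positivity)
  subst hy
  exact ⟨x, by simpa [pow_eq_one_iff_of_nonneg] using hnorm, hproj⟩

end RealAndImaginaryParts

/-! ### States dominating only real pure states -/

section SpectralDecomposition

theorem exists_spectral_decomposition {ι : Type} [Fintype ι] [DecidableEq ι] {ρ : Matrix ι ι ℂ}
    (hρ : ρ ∈ states ι) :
    ∃ (p : ι → ℝ) (v : ι → ι → ℂ), (∀ i, 0 ≤ p i) ∧ ∑ i, p i = 1 ∧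
      (∀ i j, star (v i) ⬝ᵥ v j = if i = j then 1 else 0) ∧ ρ = ∑ i, p i • proj (v i) := by
  have hH := hρ.1.1
  have hv : ∀ i j, star (⇑(hH.eigenvectorBasis i) : ι → ℂ) ⬝ᵥ ⇑(hH.eigenvectorBasis j) =
      if i = j then 1 else 0 := by
    intro i j
    rw [← orthonormal_iff_ite.1 hH.eigenvectorBasis.orthonormal i j, dotProduct_comm]
    rfl
  have hdec : ρ = ∑ i, hH.eigenvalues i • proj ⇑(hH.eigenvectorBasis i) := by
    let U : Matrix ι ι ℂ := (hH.eigenvectorUnitary : Matrix ι ι ℂ)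
    have h1 : ρ = U * Matrix.diagonal (fun j => (hH.eigenvalues j : ℂ)) * Uᴴ := by
      conv_lhs => rw [hH.spectral_theorem]
      rfl
    conv_lhs => rw [h1]
    ext i j
    rw [Matrix.sum_apply, Matrix.mul_apply]
    refine Finset.sum_congr rfl fun k _ => ?_
    rw [Matrix.mul_diagonal, Matrix.conjTranspose_apply]
    simp only [U, Matrix.IsHermitian.eigenvectorUnitary_apply, proj, Matrix.smul_apply,
      Matrix.vecMulVec_apply, Pi.star_apply, Complex.real_smul]
    ring
  refine ⟨hH.eigenvalues, fun i => ⇑(hH.eigenvectorBasis i), hρ.1.eigenvalues_nonneg, ?_, hv, hdec⟩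
  have h1 := congrArg Matrix.trace hdec
  simp only [hρ.2, Matrix.trace_sum, Matrix.trace_smul, trace_proj, hv, if_true] at h1
  rw [← Finset.sum_smul, Complex.real_smul, mul_one] at h1
  exact_mod_cast h1.symm

variable {ι : Type} [Fintype ι]

/-- The equal superposition of `v` and `w` with relative phase `c`. -/
def superposition (v w : ι → ℂ) (c : ℂ) : ι → ℂ := ((Real.sqrt 2)⁻¹ : ℂ) • (v + c • w)

theorem proj_superposition_apply {ι : Type} (v w : ι → ℂ) {c : ℂ} (hc : c * star c = 1) (i j : ι) :
    2 * proj (superposition v w c) i j =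
      proj v i j + proj w i j + (c * (w i * star (v j)) + star c * (v i * star (w j))) := by
  have h2 : ((Real.sqrt 2)⁻¹ : ℂ) * ((Real.sqrt 2)⁻¹ : ℂ) * 2 = 1 := by
    rw [← mul_inv, ← Complex.ofReal_mul, Real.mul_self_sqrt (by norm_num)]
    simp
  rw [superposition, proj_smul]
  simp only [proj, Matrix.smul_apply, Matrix.vecMulVec_apply, Pi.star_apply, Pi.add_apply,
    Pi.smul_apply, smul_eq_mul, star_add, star_mul', star_inv₀]
  rw [Complex.star_def, Complex.conj_ofReal, ← Complex.star_def]
  linear_combination (v i + c * w i) * (star (v j) + star c * star (w j)) * h2 +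
    (w i * star (w j)) * hc

/-- Two eigenvectors taken with equal weight can be exchanged for their two superpositions, so each
superposition lies below a multiple of `ρ`. -/
theorem proj_superposition_add_neg {ι : Type} (v w : ι → ℂ) {c : ℂ} (hc : c * star c = 1) :
    proj (superposition v w c) + proj (superposition v w (-c)) = proj v + proj w := by
  ext i j
  have h1 := proj_superposition_apply v w hc i j
  have h2 := proj_superposition_apply v w (c := -c) (by simpa using hc) i j
  rw [star_neg] at h2
  rw [Matrix.add_apply, Matrix.add_apply]
  linear_combination (1 / 2) * h1 + (1 / 2) * h2

theorem star_dotProduct_superposition {v w : ι → ℂ} {c : ℂ} (hc : c * star c = 1)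
    (hv : star v ⬝ᵥ v = 1) (hw : star w ⬝ᵥ w = 1) (hvw : star v ⬝ᵥ w = 0) :
    star (superposition v w c) ⬝ᵥ superposition v w c = 1 := by
  have hwv : star w ⬝ᵥ v = 0 := by
    rw [Matrix.star_dotProduct, hvw, star_zero]
  have h2 : ((Real.sqrt 2)⁻¹ : ℂ) * ((Real.sqrt 2)⁻¹ : ℂ) * 2 = 1 := by
    rw [← mul_inv, ← Complex.ofReal_mul, Real.mul_self_sqrt (by norm_num)]
    simp
  rw [superposition, star_smul, smul_dotProduct, dotProduct_smul, star_add, star_smul,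
    add_dotProduct, dotProduct_add, dotProduct_add, smul_dotProduct, smul_dotProduct,
    dotProduct_smul, dotProduct_smul, hv, hw, hvw, hwv]
  rw [star_inv₀, Complex.star_def, Complex.conj_ofReal, ← Complex.star_def]
  simp only [smul_eq_mul]
  linear_combination h2 + ((Real.sqrt 2)⁻¹ : ℂ) * ((Real.sqrt 2)⁻¹ : ℂ) * hc

/-- Two orthonormal vectors have a superposition that is not real up to a phase. -/
theorem false_of_forall_superposition_im_eq_zero {v w : ι → ℂ}
    (hv : star v ⬝ᵥ v = 1) (hw : star w ⬝ᵥ w = 1) (hvw : star v ⬝ᵥ w = 0)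
    (h : ∀ c : ℂ, c * star c = 1 → ∀ i j, (proj (superposition v w c) i j).im = 0)
    (hvr : ∀ i j, (proj v i j).im = 0) (hwr : ∀ i j, (proj w i j).im = 0) : False := by
  have him : ∀ c : ℂ, c * star c = 1 → ∀ i j,
      (c * (w i * star (v j)) + star c * (v i * star (w j))).im = 0 := by
    intro c hc i j
    have h1 := congrArg Complex.im (proj_superposition_apply v w hc i j)
    have h2 : (2 * proj (superposition v w c) i j).im = 0 := by simp [h c hc i j]
    rw [h2, Complex.add_im, Complex.add_im, hvr, hwr] at h1
    simpa using h1.symm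
  -- The phase `1` gives the imaginary part and the phase `Complex.I` the real part.
  have hsymm : ∀ i j, w i * star (v j) = w j * star (v i) := by
    intro i j
    have h1 := him 1 (by simp) i j
    have h2 := him Complex.I (by simp) i j
    simp at h1 h2
    apply Complex.ext
    · simp
      linarith
    · simp
      linarith
  have hvsymm : ∀ i j, v i * star (v j) = star (v i) * v j := by
    intro i j
    have h1 := hvr i j
    simp [proj, Matrix.vecMulVec_apply] at h1
    apply Complex.ext
    · simp
    · simp
      linarith
  have hwv : ∀ i, w i = star (v i) * ∑ j, w j * v j := by
    intro i
    calc w i = w i * (star v ⬝ᵥ v) := by rw [hv, mul_one]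
      _ = ∑ j, w i * star (v j) * v j := by
        rw [dotProduct, Finset.mul_sum]
        simp only [Pi.star_apply, mul_assoc]
      _ = _ := by
        rw [Finset.mul_sum]
        refine Finset.sum_congr rfl fun j _ => ?_
        rw [hsymm]
        ring
  have hvv : ∀ i, v i = star (v i) * ∑ j, v j * v j := by
    intro i
    calc v i = v i * (star v ⬝ᵥ v) := by rw [hv, mul_one]
      _ = ∑ j, v i * star (v j) * v j := by
        rw [dotProduct, Finset.mul_sum]
        simp only [Pi.star_apply, mul_assoc]
      _ = _ := by
        rw [Finset.mul_sum]
        refine Finset.sum_congr rfl fun j _ => ?_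
        rw [hvsymm]
        ring
  have hne : ∑ j, v j * v j ≠ 0 := by
    intro h0
    have : v = 0 := by
      ext i
      rw [hvv i, h0, mul_zero]
      rfl
    simp [this] at hv
  have hs : (∑ j, w j * v j) = 0 := by
    have h1 : (∑ j, w j * v j) * star (∑ j, v j * v j) = 0 := by
      rw [← hvw, dotProduct, star_sum, Finset.mul_sum]
      refine Finset.sum_congr rfl fun i _ => ?_
      rw [hwv i, Pi.star_apply, star_mul']
      ring
    exact (mul_eq_zero.1 h1).resolve_right (star_ne_zero.2 hne)
  have : w = 0 := by
    ext i
    rw [hwv i, hs, mul_zero]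
    rfl
  simp [this] at hw

/-- If every pure state below a multiple of `ρ` is real, then `ρ` is a real pure state. -/
theorem mem_realPureStates_of_forall_le [DecidableEq ι] {ρ : Matrix ι ι ℂ} (hρ : ρ ∈ states ι)
    (h : ∀ (ψ : ι → ℂ) (p : ℝ), star ψ ⬝ᵥ ψ = 1 → 0 < p → (ρ - p • proj ψ).PosSemidef →
      ∀ i j, (proj ψ i j).im = 0) : ρ ∈ realPureStates ι := by
  obtain ⟨p, v, hp, hsum, hv, hdec⟩ := exists_spectral_decomposition hρ
  have hunit : ∀ i, star (v i) ⬝ᵥ v i = 1 := fun i => by simp [hv]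
  obtain ⟨m, hm⟩ : ∃ m, 0 < p m := by
    by_contra! hcon
    have : ∑ i, p i ≤ 0 := Finset.sum_nonpos fun i _ => hcon i
    linarith
  have hreal : ∀ m, 0 < p m → ∀ i j, (proj (v m) i j).im = 0 := by
    intro m hm
    refine h (v m) (p m) (hunit m) hm ?_
    rw [hdec, ← Finset.add_sum_erase _ _ (Finset.mem_univ m), add_sub_cancel_left]
    exact Matrix.posSemidef_sum _ fun i _ => (posSemidef_proj _).smul (hp i)
  have hzero : ∀ n, n ≠ m → p n = 0 := by
    intro n hnm
    by_contra hn0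
    have hn : 0 < p n := lt_of_le_of_ne (hp n) (Ne.symm hn0)
    refine false_of_forall_superposition_im_eq_zero (hunit m) (hunit n) (by simp [hv, hnm.symm]) ?_
      (hreal m hm) (hreal n hn)
    intro c hc
    refine h _ (min (p m) (p n)) (star_dotProduct_superposition hc (hunit m) (hunit n)
      (by simp [hv, hnm.symm])) (lt_min hm hn) ?_
    have h1 : ρ - min (p m) (p n) • proj (superposition (v m) (v n) c) =
        (p m - min (p m) (p n)) • proj (v m) + (p n - min (p m) (p n)) • proj (v n) +
        min (p m) (p n) • proj (superposition (v m) (v n) (-c)) +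
        ∑ i ∈ (Finset.univ.erase m).erase n, p i • proj (v i) := by
      have h2 := proj_superposition_add_neg (v m) (v n) hc
      rw [← eq_sub_iff_add_eq'] at h2
      rw [hdec, ← Finset.add_sum_erase _ _ (Finset.mem_univ m), ← Finset.add_sum_erase
        (Finset.univ.erase m) _ (Finset.mem_erase.2 ⟨hnm, Finset.mem_univ n⟩), h2]
      simp only [smul_sub, smul_add, sub_smul]
      abel
    rw [h1]
    refine Matrix.PosSemidef.add (Matrix.PosSemidef.add (Matrix.PosSemidef.add ?_ ?_) ?_) ?_
    · exact (posSemidef_proj _).smul (sub_nonneg.2 (min_le_left _ _))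
    · exact (posSemidef_proj _).smul (sub_nonneg.2 (min_le_right _ _))
    · exact (posSemidef_proj _).smul (lt_min hm hn).le
    · exact Matrix.posSemidef_sum _ fun i _ => (posSemidef_proj _).smul (hp i)
  have hpm : p m = 1 := by
    rw [← hsum, Finset.sum_eq_single m (fun n _ hn => hzero n hn) (by simp)]
  have hρm : ρ = proj (v m) := by
    rw [hdec, Finset.sum_eq_single m (fun n _ hn => by rw [hzero n hn, zero_smul]) (by simp), hpm,
      one_smul]
  exact ⟨⟨hρ, v m, hρm⟩, hρ, by rw [hρm]; exact hreal m hm⟩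

end SpectralDecomposition

/-! ### Application to the masker -/

section MaskedFamily

variable {d a b : ℕ}

/-- A mixture of states, each obtained by a two-outcome measurement of Bob and contractions of
Alice. -/
theorem loccConvertible_mixture {X : Matrix (Fin a × Fin b) (Fin a × Fin b) ℂ} (hX : X.PosSemidef)
    {R : Matrix (Fin b) (Fin b) ℂ} (hR : (1 - R).PosSemidef)
    {Y : Fin d → Matrix (Fin a × Fin b) (Fin a × Fin b) ℂ}
    {p : Fin d → ℝ} (hp : ∀ i, 0 ≤ p i) (hsum : ∑ i, p i = 1)
    {K : Fin d → Fin 2 → Matrix (Fin b) (Fin b) ℂ} {U : Fin d → Fin 2 → Matrix (Fin a) (Fin a) ℂ}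
    (hKU : ∀ i s, (U i s ⊗ₖ K i s) * X * (U i s ⊗ₖ K i s)ᴴ = Y i)
    (hKK : ∀ i, ∑ s, (K i s)ᴴ * K i s = (2 : ℝ) • R)
    (hU : ∀ i s, (1 - (U i s)ᴴ * U i s).PosSemidef) (htr : ∀ i, (Y i).trace = X.trace) :
    LOCCConvertible X (∑ i, p i • Y i) := by
  -- Each pair of Kraus operators sums to `2 R`; the weights `p i / 2` make the whole family sum to
  -- `R`.
  obtain ⟨r, hrr⟩ : ∃ r : Fin d → ℝ, ∀ i, r i * r i = p i / 2 :=
    ⟨fun i => Real.sqrt (p i / 2), fun i => Real.mul_self_sqrt (div_nonneg (hp i) zero_le_two)⟩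
  have hK' : ∑ q : Fin d × Fin 2, (r q.1 • K q.1 q.2)ᴴ * (r q.1 • K q.1 q.2) = R := by
    rw [Fintype.sum_prod_type]
    simp only [Matrix.conjTranspose_smul, Matrix.smul_mul, Matrix.mul_smul, smul_smul,
      star_trivial, hrr]
    simp only [← Finset.smul_sum, hKK, smul_smul]
    rw [← Finset.sum_smul]
    simp [hsum]
  have hout : ∑ q : Fin d × Fin 2, (U q.1 q.2 ⊗ₖ (r q.1 • K q.1 q.2)) * X *
      (U q.1 q.2 ⊗ₖ (r q.1 • K q.1 q.2))ᴴ = ∑ i, p i • Y i := by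
    rw [Fintype.sum_prod_type]
    refine Finset.sum_congr rfl fun i _ => ?_
    simp only [Matrix.kronecker_smul, Matrix.conjTranspose_smul, Matrix.smul_mul, Matrix.mul_smul,
      smul_smul, star_trivial, hrr, hKU]
    rw [Fin.sum_univ_two, ← add_smul, add_halves]
  have h := loccConvertible_of_contractions (ι := Fin d × Fin 2)
    (K := fun q => r q.1 • K q.1 q.2) (U := fun q => U q.1 q.2)
    (by rwa [hK']) (fun q => hU q.1 q.2) hX
  rw [hout] at h
  apply h
  simp only [Matrix.trace_sum, Matrix.trace_smul, htr]
  rw [← Finset.sum_smul, hsum, one_smul]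

/-- Coefficient matrices of the images of real vectors. -/
def coeffFamily (M : Matrix (Fin a × Fin b) (Fin d) ℂ) :
    EuclideanSpace ℝ (Fin d) →ₗ[ℝ] Matrix (Fin b) (Fin a) ℂ where
  toFun x := Matrix.of fun k i => (M *ᵥ complexVec x 0) (i, k)
  map_add' x y := by
    ext k i
    simp [complexVec, Matrix.mulVec, dotProduct, mul_add, Finset.sum_add_distrib]
  map_smul' r x := by
    ext k i
    simp [complexVec, Matrix.mulVec, dotProduct, Finset.mul_sum, mul_left_comm]

theorem vec_coeffFamily (M : Matrix (Fin a × Fin b) (Fin d) ℂ) (x : EuclideanSpace ℝ (Fin d)) :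
    (coeffFamily M x).vec = M *ᵥ complexVec x 0 := rfl

theorem vec_coeffFamily_add_I_smul (M : Matrix (Fin a × Fin b) (Fin d) ℂ)
    (x y : EuclideanSpace ℝ (Fin d)) :
    (coeffFamily M x + Complex.I • coeffFamily M y).vec = M *ᵥ complexVec x y := by
  have h : complexVec x y = complexVec x 0 + Complex.I • complexVec y 0 := by
    ext j
    simp [complexVec]
  rw [h, Matrix.mulVec_add, Matrix.mulVec_smul]
  rfl

theorem proj_complexVec_mem_realStates {x : EuclideanSpace ℝ (Fin d)} (hx : ‖x‖ = 1) :
    proj (complexVec x 0) ∈ realStates (Fin d) :=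
  ⟨(proj_mem_pureStates (by simp [star_dotProduct_complexVec, hx])).1, proj_complexVec_zero_im x⟩

/-- Masking is applied to real unit vectors only; homogeneity extends the identities to all `x`. -/
theorem IsMasker.exists_marginals {M : Matrix (Fin a × Fin b) (Fin d) ℂ}
    (hM : IsMasker M (realStates (Fin d))) :
    ∃ (σ : Matrix (Fin b) (Fin b) ℂ) (τ : Matrix (Fin a) (Fin a) ℂ),
      (∀ x, coeffFamily M x * (coeffFamily M x)ᴴ = (‖x‖ ^ 2) • σ) ∧
      (∀ x, (coeffFamily M x)ᴴ * coeffFamily M x = (‖x‖ ^ 2) • τ) := by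
  obtain ⟨-, τA, -, τB, -, h⟩ := hM
  have h1 : ∀ x : EuclideanSpace ℝ (Fin d), ‖x‖ = 1 →
      traceB (proj (coeffFamily M x).vec) = τA ∧ traceA (proj (coeffFamily M x).vec) = τB := by
    intro x hx
    rw [vec_coeffFamily, proj_mulVec]
    exact h _ (proj_complexVec_mem_realStates hx)
  refine ⟨τB, τAᵀ, fun x => ?_, fun x => ?_⟩
  all_goals
    by_cases hx : x = 0
    · simp [hx]
    have hn : ‖x‖ ≠ 0 := norm_ne_zero_iff.2 hx
    have hu : ‖(‖x‖⁻¹) • x‖ = 1 := by simp [norm_smul, hn]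
    have hxu : ‖x‖ • (‖x‖⁻¹) • x = x := smul_inv_smul₀ hn x
    generalize (‖x‖⁻¹) • x = u at hu hxu
    generalize ‖x‖ = r at hxu
    rw [← hxu, map_smul, Matrix.conjTranspose_smul, Matrix.smul_mul, Matrix.mul_smul, smul_smul,
      star_trivial, ← sq]
  · rw [mul_conjTranspose_self_eq_traceA, (h1 u hu).2]
  · rw [conjTranspose_mul_self_eq_traceB, (h1 u hu).1]

variable {M : Matrix (Fin a × Fin b) (Fin d) ℂ}

theorem star_dotProduct_isometry_mulVec (hM : Mᴴ * M = 1) (ψ : Fin d → ℂ) :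
    star (M *ᵥ ψ) ⬝ᵥ M *ᵥ ψ = star ψ ⬝ᵥ ψ := by
  rw [Matrix.star_mulVec, ← Matrix.dotProduct_mulVec, Matrix.mulVec_mulVec, hM, Matrix.one_mulVec]

/-- Any encoded state can be created from the encoding of any real pure state. -/
theorem IsMasker.loccConvertible (hd : 3 ≤ d) (hM : IsMasker M (realStates (Fin d)))
    {u₀ : EuclideanSpace ℝ (Fin d)} (hu₀ : ‖u₀‖ = 1) {ρ : Matrix (Fin d) (Fin d) ℂ}
    (hρ : ρ ∈ states (Fin d)) :
    LOCCConvertible (proj (M *ᵥ complexVec u₀ 0)) (M * ρ * Mᴴ) := by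
  obtain ⟨σ, τ, hl, hr⟩ := hM.exists_marginals
  obtain ⟨R, hR, hops⟩ := exists_local_operations hl hr (by simpa using hd) hu₀
  obtain ⟨p, v, hp, hsum, hv, hdec⟩ := exists_spectral_decomposition hρ
  have hops' : ∀ i, ∃ (K : Fin 2 → Matrix (Fin b) (Fin b) ℂ) (U : Fin 2 → Matrix (Fin a) (Fin a) ℂ),
      (∀ s, proj ((U s ⊗ₖ K s) *ᵥ (M *ᵥ complexVec u₀ 0)) = proj (M *ᵥ v i)) ∧
      ∑ s, (K s)ᴴ * K s = (2 : ℝ) • R ∧ ∀ s, (1 - (U s)ᴴ * U s).PosSemidef := by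
    intro i
    obtain ⟨x, y, hxy, hx, hnorm, hproj⟩ := exists_orthogonal_parts (ψ := v i) (by simp [hv])
    obtain ⟨K, Y, hK, hKK, hY⟩ := hops x y hxy hx
    refine ⟨K, fun s => (Y s)ᵀ, fun s => ?_, by rw [hKK, hnorm, mul_one], fun s => ?_⟩
    · rw [← vec_coeffFamily, Matrix.kronecker_mulVec_vec, Matrix.transpose_transpose, hK,
        vec_coeffFamily_add_I_smul, proj_mulVec, proj_mulVec, hproj]
    · have h1 : 1 - ((Y s)ᵀ)ᴴ * (Y s)ᵀ = (1 - Y s * (Y s)ᴴ)ᵀ := by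
        rw [Matrix.transpose_sub, Matrix.transpose_one, Matrix.transpose_mul]
        rfl
      rw [h1]
      exact (hY s).transpose
  choose K U hKU hKK hU using hops'
  have hmix := loccConvertible_mixture (posSemidef_proj (M *ᵥ complexVec u₀ 0)) hR
    (Y := fun i => proj (M *ᵥ v i)) hp hsum
    (fun i s => by rw [← proj_mulVec, hKU]) hKK hU (fun i => by
      rw [trace_proj, trace_proj, star_dotProduct_isometry_mulVec hM.1,
        star_dotProduct_isometry_mulVec hM.1, star_dotProduct_complexVec, hu₀, hv]
      simp)
  have hout : M * ρ * Mᴴ = ∑ i, p i • proj (M *ᵥ v i) := by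
    conv_lhs => rw [hdec, Matrix.mul_sum, Matrix.sum_mul]
    refine Finset.sum_congr rfl fun i _ => ?_
    rw [proj_mulVec, Matrix.mul_smul, Matrix.smul_mul]
  rwa [hout]

/-- If the encoding of a pure state can be turned into the encoding of a real pure state, then it
is itself real. -/
theorem IsMasker.proj_im_eq_zero (hd : 3 ≤ d) (hM : IsMasker M (realStates (Fin d)))
    {u₀ : EuclideanSpace ℝ (Fin d)} (hu₀ : ‖u₀‖ = 1) {ψ : Fin d → ℂ} (hψ : star ψ ⬝ᵥ ψ = 1)
    (h : LOCCConvertible (M * proj ψ * Mᴴ) (proj (M *ᵥ complexVec u₀ 0))) (i j : Fin d) :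
    (proj ψ i j).im = 0 := by
  obtain ⟨σ, τ, hl, hr⟩ := hM.exists_marginals
  obtain ⟨x, y, hxy, hx, hnorm, hproj⟩ := exists_orthogonal_parts hψ
  have hτ : (coeffFamily M u₀)ᴴ * coeffFamily M u₀ = τ := by simp [hr, hu₀]
  have hS : star (coeffFamily M u₀).vec ⬝ᵥ (coeffFamily M u₀).vec = 1 := by
    rw [vec_coeffFamily, star_dotProduct_isometry_mulVec hM.1, star_dotProduct_complexVec, hu₀]
    simp
  have hτ0 : τ ≠ 0 := by
    intro h0
    rw [h0, Matrix.conjTranspose_mul_self_eq_zero] at hτ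
    simp [hτ] at hS
  -- `l` is the largest squared Schmidt coefficient of the encoded real state.
  obtain ⟨l, e, hl0, he, hτe, hlτ⟩ := exists_top_eigenvector
    (hτ ▸ Matrix.posSemidef_conjTranspose_mul_self _) hτ0
  obtain ⟨q, hq⟩ := h
  rw [hproj, ← proj_mulVec, ← vec_coeffFamily_add_I_smul, ← vec_coeffFamily] at hq
  have h1 := q.posSemidef_sub_of_channel_eq hS hl0.le (by rwa [hτ]) _ 1 zero_le_one
    (by rw [hq, one_smul])
  rw [one_mul] at h1
  have hy := eq_zero_of_posSemidef_sub hl hr (by simpa using hd) hxy hx hnorm hl0 he hτe h1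
  rw [hproj, hy]
  exact proj_complexVec_zero_im x i j

end MaskedFamily

end Masking

end

/-! ### The three claims -/

theorem theorem5 {d a b : ℕ} (hd : 3 ≤ d) (M : Matrix (Fin a × Fin b) (Fin d) ℂ)
    (hM : Masking.IsMasker M (Masking.realStates (Fin d)))
    (Ψ₀ : Fin a × Fin b → ℂ)
    (hΨ₀ : Ψ₀ = M *ᵥ Pi.single (⟨0, by omega⟩ : Fin d) 1) :
    (∀ ρ ∈ Masking.states (Fin d),
      Masking.LOCCConvertible (Masking.proj Ψ₀) (M * ρ * Mᴴ)) ∧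
    (∀ E : Matrix (Fin a × Fin b) (Fin a × Fin b) ℂ → ℝ, Masking.IsEntanglementMonotone E →
      ∀ ρ ∈ Masking.states (Fin d), E (M * ρ * Mᴴ) ≤ E (Masking.proj Ψ₀)) ∧
    (∀ E : Matrix (Fin a × Fin b) (Fin a × Fin b) ℂ → ℝ,
      Masking.IsStrictEntanglementMonotone E →
      ConvexOn ℝ (Masking.states (Fin a × Fin b)) E →
      ∀ ρ ∈ Masking.states (Fin d),
        (E (M * ρ * Mᴴ) = E (Masking.proj Ψ₀) ↔ ρ ∈ Masking.realPureStates (Fin d))) := by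
  open Masking in
  let u₀ : EuclideanSpace ℝ (Fin d) := EuclideanSpace.single (⟨0, by omega⟩ : Fin d) 1
  have hu₀ : ‖u₀‖ = 1 := by simp [u₀]
  have hvec : (Pi.single (⟨0, by omega⟩ : Fin d) 1 : Fin d → ℂ) = complexVec u₀ 0 := by
    ext j
    by_cases hj : j = ⟨0, by omega⟩
    · simp [u₀, complexVec, hj]
    · simp [u₀, complexVec, hj]
  rw [hvec] at hΨ₀
  subst hΨ₀
  have hunit : star (complexVec u₀ 0) ⬝ᵥ complexVec u₀ 0 = 1 := by
    simp [star_dotProduct_complexVec, hu₀]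
  have hpure : ∀ ψ : Fin d → ℂ, star ψ ⬝ᵥ ψ = 1 → proj (M *ᵥ ψ) ∈ pureStates (Fin a × Fin b) :=
    fun ψ hψ => proj_mem_pureStates (by rw [star_dotProduct_isometry_mulVec hM.1, hψ])
  have hle : ∀ E : Matrix (Fin a × Fin b) (Fin a × Fin b) ℂ → ℝ, IsEntanglementMonotone E →
      ∀ ρ ∈ states (Fin d), E (M * ρ * Mᴴ) ≤ E (proj (M *ᵥ complexVec u₀ 0)) :=
    fun E hE ρ hρ => hE _ (hpure _ hunit).1 _ (isometry_mul_mul_mem_states hM.1 hρ)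
      (hM.loccConvertible hd hu₀ hρ)
  refine ⟨fun ρ hρ => hM.loccConvertible hd hu₀ hρ, hle, ?_⟩
  intro E hE hconv ρ hρ
  constructor
  · intro heq
    refine mem_realPureStates_of_forall_le hρ fun ψ p hψ hp hpsd => ?_
    have hψs : proj ψ ∈ states (Fin d) := (proj_mem_pureStates hψ).1
    -- Split `ρ` into `proj ψ` with weight `p` and a remainder. The remainder has value at most that
    -- of `Ψ₀`, so equality for `ρ` and convexity push `proj ψ` up to it; `p = 1` leaves no
    -- remainder to normalize.
    have hge : E (proj (M *ᵥ complexVec u₀ 0)) ≤ E (M * proj ψ * Mᴴ) := by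
      have htr : (ρ - p • proj ψ).trace = ((1 - p : ℝ) : ℂ) := by
        rw [Matrix.trace_sub, Matrix.trace_smul, hρ.2, hψs.2]
        simp
      have hp1 : p ≤ 1 := by
        have := hpsd.trace_nonneg
        rw [htr] at this
        have := Complex.zero_le_real.1 this
        linarith
      rcases hp1.eq_or_lt with rfl | hp1
      · have : ρ - (1 : ℝ) • proj ψ = 0 := by
          rw [← hpsd.trace_eq_zero_iff, htr]
          simp
        rw [one_smul, sub_eq_zero] at this
        rw [← this, heq]
      · have h1p : 0 < 1 - p := by linarith
        have hσ : (1 - p)⁻¹ • (ρ - p • proj ψ) ∈ states (Fin d) := by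
          refine ⟨hpsd.smul (inv_nonneg.2 h1p.le), ?_⟩
          rw [Matrix.trace_smul, htr, Complex.real_smul, ← Complex.ofReal_mul,
            inv_mul_cancel₀ h1p.ne', Complex.ofReal_one]
        have hmix : M * ρ * Mᴴ = p • (M * proj ψ * Mᴴ) +
            (1 - p) • (M * ((1 - p)⁻¹ • (ρ - p • proj ψ)) * Mᴴ) := by
          rw [Matrix.mul_smul, Matrix.smul_mul, smul_smul, mul_inv_cancel₀ h1p.ne', one_smul,
            Matrix.mul_sub, Matrix.sub_mul, Matrix.mul_smul, Matrix.smul_mul]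
          abel
        have h1 := hconv.2 (isometry_mul_mul_mem_states hM.1 hψs)
          (isometry_mul_mul_mem_states hM.1 hσ) hp.le h1p.le (by ring)
        rw [← hmix, heq] at h1
        have h2 := hle E hE.1 _ hσ
        simp only [smul_eq_mul] at h1
        have h3 := mul_le_mul_of_nonneg_left h2 h1p.le
        nlinarith
    refine hM.proj_im_eq_zero hd hu₀ hψ ?_
    -- `Ψ₀` can be turned into the encoding of `ψ`; were there no way back, strictness would
    -- contradict `hge`.
    by_contra hnot
    rw [← proj_mulVec] at hnot hge
    have hconvert : LOCCConvertible (proj (M *ᵥ complexVec u₀ 0)) (proj (M *ᵥ ψ)) := by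
      rw [proj_mulVec M ψ]
      exact hM.loccConvertible hd hu₀ hψs
    exact absurd (hE.2 _ (hpure _ hunit) _ (hpure _ hψ) hconvert hnot) (not_lt.2 hge)
  · rintro ⟨⟨-, ψ, rfl⟩, -, him⟩
    have hψ : star ψ ⬝ᵥ ψ = 1 := by rw [← trace_proj, hρ.2]
    refine le_antisymm (hle E hE.1 _ hρ) ?_
    -- Any real unit vector may replace the initial basis vector, so `Ψ₀` is in turn created from
    -- the encoding of `ρ`.
    obtain ⟨x, hx, hproj⟩ := exists_real_vector_of_im_eq_zero hψ him
    refine hE.1 _ (isometry_mul_mul_mem_states hM.1 hρ) _ (hpure _ hunit).1 ?_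
    rw [hproj, ← proj_mulVec, proj_mulVec M (complexVec u₀ 0)]
    exact hM.loccConvertible hd hx (proj_mem_pureStates hunit).1
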